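/- Let $V\subset\mathbb Z^d$ be finite, $\lambda,\kappa\ge 0$, $\gamma>0$. Let $p$ be a symmetric probability distribution on $\mathbb Z^d$, $p(z)=p(-z)$, with $\sum_z e^{\langle\alpha,z\rangle}p(z)<\infty$ for all $\alpha\in\mathbb R^d$, and let $\pi(v,v')\ge 0$ ($v\ne v'$ in $V$) be the rates of an irreducible continuous-time Markov chain on $V$, with generator $Af(v)=\sum_{v'\in V}\pi(v,v')(f(v')-f(v))$. Let $\{(X_t,v_t):t\ge 0\}$ be the Markov process on $\mathbb Z^d\times V$ with generator $$Lf(x,v)=\lambda\,(f(x+v,v)-f(x,v))+\kappa\sum_{z}p(z)(f(x+z,v)-f(x,v))+\gamma\sum_{v'\in V}\pi(v,v')(f(x,v')-f(x,v)),$$ started from $X_0=0$ and an arbitrary (random) initial velocity. Put $\Gamma(\alpha)=\sum_z p(z)(e^{\langle\alpha,z\rangle}-1)$, $\psi_\alpha(v)=\kappa\Gamma(\alpha)+\lambda(e^{\langle\alpha,v\rangle}-1)$, and $M(\alpha)=\gamma A+\mathrm{diag}(\psi_\alpha)$, where $A$ also denotes the matrix of the generator $A$: $A_{v,v'}=\pi(v,v')$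 for $v\neq v'$ and $A_{v,v}=-\sum_{v'\ne v}\pi(v,v')$. Let $\mathcal P(V)$ be the set of probability measures on $V$ and, for $\mu\in\mathcal P(V)$, let $I_A(\mu)=-\inf_{f>0}\sum_v\mu(v)\frac{Af(v)}{f(v)}$. Then for every $\alpha\in\mathbb R^d$ one has $\mathbb E\,e^{\langle\alpha,X_t\rangle}<\infty$ for all $t\ge 0$, and the limit $$F(\alpha)=\lim_{t\to\infty}\frac1t\log\mathbb E\, e^{\langle\alpha,X_t\rangle}\in\mathbb R$$ exists. It is the largest eigenvalue of $M(\alpha)$ (that is, $F(\alpha)$ is an eigenvalue of $M(\alpha)$, and every complex eigenvalue of $M(\alpha)$ has real part at most $F(\alpha)$), and $$F(\alpha)=\sup_{\mu\in\mathcal P(V)}\Big(\sum_v\psi_\alpha(v)\mu(v)-\gamma I_A(\mu)\Big)=\kappa\Gamma(\alpha)+\sup_{\mu\in\mathcal P(V)}\Big(\sum_v\lambda(e^{\langle\alpha,v\rangle}-1)\mu(v)-\gamma I_A(\mu)\Big).$$ If moreover $\pi(v,v')=\pi(v',v)$ for all $v,v'$, then $$F(\alpha)=\sup_{\mu\in\mathcal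 P(V)}\Big(\sum_v\psi_\alpha(v)\mu(v)+\gamma\sum_{v,v'}\sqrt{\mu(v)}\sqrt{\mu(v')}\,A_{v,v'}\Big).$$ Finally, as $t\to\infty$, $X_t/t$ satisfies the large deviation principle on $\mathbb R^d$ with speed $t$ and good rate function $I(x)=\sup_{\alpha\in\mathbb R^d}(\langle\alpha,x\rangle-F(\alpha))\in[0,\infty]$: $I$ is lower semicontinuous with compact sublevel sets, and $$\limsup_{t\to\infty}\frac1t\log\mathbb P\Big(\frac{X_t}{t}\in B\Big)\le-\inf_{x\in B}I(x)\ \ (B\text{ closed}),\qquad \liminf_{t\to\infty}\frac1t\log\mathbb P\Big(\frac{X_t}{t}\in G\Big)\ge-\inf_{x\in G}I(x)\ \ (G\text{ open}).$$ -/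

import Mathlib

open MeasureTheory Filter Topology
open scoped NNReal BoundedContinuousFunction

noncomputable section

/-- The lattice `ℤ^d`. -/
abbrev IntLattice (d : ℕ) : Type := Fin d → ℤ

/-- A point of `ℤ^d`, seen as a point of Euclidean space `ℝ^d`. -/
def latticeVec {d : ℕ} (x : IntLattice d) : EuclideanSpace ℝ (Fin d) :=
  WithLp.toLp 2 (fun i => (x i : ℝ))

/-- The semigroup `exp (t L)` of a bounded operator `L` on a real normed space. -/
def expSemigroup {B : Type*} [NormedAddCommGroup B] [NormedSpace ℝ B] (L : B →L[ℝ] B) (t : ℝ≥0) :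
    B →L[ℝ] B :=
  NormedSpace.exp ((t : ℝ) • L)

/-- The parameters of the general lattice active particle on `ℤ^d`, with their standing
assumptions: a finite velocity set `V`, the rates `lam` of transport, `kap` of diffusion and `gam`
of flipping, a symmetric probability distribution `p` on `ℤ^d` with all exponential moments, and
velocity flip rates `flip v v'` (`v ≠ v'`; the diagonal plays no role) which generate an irreducible
continuous-time Markov chain on `V`. -/
structure ActiveParticleModel (d : ℕ) where
  V : Finset (IntLattice d)
  lam : ℝ
  kap : ℝ
  gam : ℝ
  p : IntLattice d → ℝ
  flip : V → V → ℝ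
  lam_nonneg : 0 ≤ lam
  kap_nonneg : 0 ≤ kap
  gam_pos : 0 < gam
  p_nonneg : ∀ z, 0 ≤ p z
  p_hasSum : HasSum p 1
  p_symm : ∀ z, p (-z) = p z
  p_exp : ∀ α : EuclideanSpace ℝ (Fin d),
    Summable fun z : IntLattice d => Real.exp (inner ℝ α (latticeVec z)) * p z
  flip_nonneg : ∀ v v', v ≠ v' → 0 ≤ flip v v'
  flip_irreducible : ∀ v v', Relation.ReflTransGen (fun a b => a ≠ b ∧ 0 < flip a b) v v'

namespace ActiveParticleModel

variable {d : ℕ} (m : ActiveParticleModel d)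

/-- The state space of the particle: pairs of a position and a velocity. -/
abbrev State : Type := IntLattice d × m.V

/-- The transport part `L_t` of the generator. -/
def transport (f : m.State → ℝ) (s : m.State) : ℝ :=
  f (s.1 + (s.2 : IntLattice d), s.2) - f s

/-- The diffusion part `L_d` of the generator. -/
def diffusion (f : m.State → ℝ) (s : m.State) : ℝ :=
  ∑' z : IntLattice d, m.p z * (f (s.1 + z, s.2) - f s)

/-- The generator `A` of the velocity flip process, on functions on `V`. -/
def flipGen (f : m.V → ℝ) (v : m.V) : ℝ :=
  ∑ v' : m.V, m.flip v v' * (f v' - f v)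

/-- The expression `L f = lam * L_t f + kap * L_d f + gam * L_f f`. -/
def generatorFun (f : m.State → ℝ) (s : m.State) : ℝ :=
  m.lam * m.transport f s + m.kap * m.diffusion f s +
    m.gam * m.flipGen (fun v => f (s.1, v)) s.2

theorem abs_sub_le_two_norm (f : m.State →ᵇ ℝ) (s s' : m.State) : |f s - f s'| ≤ 2 * ‖f‖ := by
  have := f.dist_le_two_norm s s'
  rwa [Real.dist_eq] at this

theorem summable_diffusion (f : m.State →ᵇ ℝ) (s : m.State) :
    Summable fun z : IntLattice d => m.p z * (f (s.1 + z, s.2) - f s) := by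
  refine Summable.of_norm_bounded (m.p_hasSum.summable.mul_right (2 * ‖f‖)) fun z => ?_
  rw [Real.norm_eq_abs, abs_mul, abs_of_nonneg (m.p_nonneg z)]
  exact mul_le_mul_of_nonneg_left (m.abs_sub_le_two_norm f _ _) (m.p_nonneg z)

theorem abs_diffusion_le (f : m.State →ᵇ ℝ) (s : m.State) : |m.diffusion f s| ≤ 2 * ‖f‖ := by
  have h := m.p_hasSum.mul_right (2 * ‖f‖)
  rw [one_mul] at h
  refine tsum_of_norm_bounded (f := fun z => m.p z * (f (s.1 + z, s.2) - f s)) h fun z => ?_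
  rw [Real.norm_eq_abs, abs_mul, abs_of_nonneg (m.p_nonneg z)]
  exact mul_le_mul_of_nonneg_left (m.abs_sub_le_two_norm f _ _) (m.p_nonneg z)

theorem abs_generatorFun_le (f : m.State →ᵇ ℝ) (s : m.State) :
    |m.generatorFun f s| ≤
      (2 * m.lam + 2 * m.kap + 2 * m.gam * ∑ v : m.V, ∑ v' : m.V, |m.flip v v'|) * ‖f‖ := by
  have h1 : |m.transport f s| ≤ 2 * ‖f‖ := m.abs_sub_le_two_norm f _ _
  have h2 := m.abs_diffusion_le f s
  have h3 : |m.flipGen (fun v => f (s.1, v)) s.2| ≤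
      (∑ v : m.V, ∑ v' : m.V, |m.flip v v'|) * (2 * ‖f‖) := by
    calc |m.flipGen (fun v => f (s.1, v)) s.2|
        ≤ ∑ v' : m.V, |m.flip s.2 v' * (f (s.1, v') - f (s.1, s.2))| :=
          Finset.abs_sum_le_sum_abs _ _
      _ ≤ ∑ v' : m.V, |m.flip s.2 v'| * (2 * ‖f‖) := by
          refine Finset.sum_le_sum fun v' _ => ?_
          rw [abs_mul]
          exact mul_le_mul_of_nonneg_left (m.abs_sub_le_two_norm f _ _) (abs_nonneg _)
      _ = (∑ v' : m.V, |m.flip s.2 v'|) * (2 * ‖f‖) := by rw [Finset.sum_mul]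
      _ ≤ _ := by
          refine mul_le_mul_of_nonneg_right ?_ (by positivity)
          exact Finset.single_le_sum (f := fun v : m.V => ∑ v' : m.V, |m.flip v v'|)
            (fun v _ => Finset.sum_nonneg fun v' _ => abs_nonneg _) (Finset.mem_univ s.2)
  have e1 := mul_le_mul_of_nonneg_left h1 m.lam_nonneg
  have e2 := mul_le_mul_of_nonneg_left h2 m.kap_nonneg
  have e3 := mul_le_mul_of_nonneg_left h3 m.gam_pos.le
  calc |m.generatorFun f s|
      ≤ |m.lam * m.transport f s| + |m.kap * m.diffusion f s| +
          |m.gam * m.flipGen (fun v => f (s.1, v)) s.2| := abs_add_three _ _ _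
    _ = m.lam * |m.transport f s| + m.kap * |m.diffusion f s| +
          m.gam * |m.flipGen (fun v => f (s.1, v)) s.2| := by
        rw [abs_mul, abs_mul, abs_mul, abs_of_nonneg m.lam_nonneg, abs_of_nonneg m.kap_nonneg,
          abs_of_pos m.gam_pos]
    _ ≤ _ := by linarith

/-- The generator `L` is a bounded operator on the Banach space of bounded functions on the
(discrete, countable) state space. -/
def generator : (m.State →ᵇ ℝ) →L[ℝ] (m.State →ᵇ ℝ) :=
  LinearMap.mkContinuous
    { toFun := fun f => BoundedContinuousFunction.ofNormedAddCommGroupDiscrete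
        (m.generatorFun f) _ (m.abs_generatorFun_le f)
      map_add' := fun f g => by
        ext s
        have h : m.diffusion (fun s => f s + g s) s = m.diffusion f s + m.diffusion g s := by
          unfold diffusion
          rw [← (m.summable_diffusion f s).tsum_add (m.summable_diffusion g s)]
          exact tsum_congr fun z => by ring
        have h' : m.flipGen (fun v => f (s.1, v) + g (s.1, v)) s.2 =
            m.flipGen (fun v => f (s.1, v)) s.2 + m.flipGen (fun v => g (s.1, v)) s.2 := by
          unfold flipGen
          rw [← Finset.sum_add_distrib]
          exact Finset.sum_congr rfl fun z _ => by ring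
        change m.generatorFun (fun s => f s + g s) s = m.generatorFun f s + m.generatorFun g s
        simp only [generatorFun, transport, h, h']
        ring
      map_smul' := fun c f => by
        ext s
        have h : m.diffusion (fun s => c * f s) s = c * m.diffusion f s := by
          unfold diffusion
          rw [← tsum_mul_left]
          exact tsum_congr fun z => by ring
        have h' : m.flipGen (fun v => c * f (s.1, v)) s.2 =
            c * m.flipGen (fun v => f (s.1, v)) s.2 := by
          unfold flipGen
          rw [Finset.mul_sum]
          exact Finset.sum_congr rfl fun z _ => by ring
        change m.generatorFun (fun s => c * f s) s = c * m.generatorFun f s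
        simp only [generatorFun, transport, h, h']
        ring }
    (2 * m.lam + 2 * m.kap + 2 * m.gam * ∑ v : m.V, ∑ v' : m.V, |m.flip v v'|)
    (fun f => by
      have h0 : 0 ≤ 2 * m.lam + 2 * m.kap + 2 * m.gam * ∑ v : m.V, ∑ v' : m.V, |m.flip v v'| := by
        have := m.lam_nonneg
        have := m.kap_nonneg
        have := m.gam_pos
        positivity
      exact (BoundedContinuousFunction.norm_le (by positivity)).2 (m.abs_generatorFun_le f))

theorem generator_apply (f : m.State →ᵇ ℝ) (s : m.State) :
    m.generator f s = m.generatorFun f s := rfl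

/-- The transition semigroup `exp (t L)` on bounded functions. -/
def semigroup (t : ℝ≥0) : (m.State →ᵇ ℝ) →L[ℝ] (m.State →ᵇ ℝ) :=
  expSemigroup m.generator t

/-- `(X, v)` is, on the probability space `(Ω, P)`, a Markov process (with respect to its natural
filtration) whose generator is `L`, started with `X_0 = 0` and an arbitrary random initial
velocity. -/
structure IsActiveParticle {Ω : Type*} [MeasurableSpace Ω] (P : Measure Ω)
    (X : ℝ≥0 → Ω → IntLattice d) (v : ℝ≥0 → Ω → m.V) : Prop where
  measurable_pos : ∀ t, Measurable (X t)
  measurable_vel : ∀ t, Measurable (v t)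
  start : ∀ᵐ ω ∂P, X 0 ω = 0
  markov : ∀ (s t : ℝ≥0) (f : m.State →ᵇ ℝ),
    P[fun ω => f (X (s + t) ω, v (s + t) ω) |
        ⨆ r ∈ Set.Iic s, MeasurableSpace.comap (fun ω => (X r ω, v r ω)) inferInstance]
      =ᵐ[P] fun ω => m.semigroup t f (X s ω, v s ω)

/-- The matrix of the velocity flip generator `A`. -/
def flipMatrix : Matrix m.V m.V ℝ := fun v v' =>
  if v = v' then -∑ w ∈ Finset.univ.erase v, m.flip v w else m.flip v v'

theorem flipMatrix_mulVec (f : m.V → ℝ) : m.flipMatrix.mulVec f = m.flipGen f := by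
  ext v
  simp only [Matrix.mulVec, dotProduct, flipGen]
  rw [← Finset.add_sum_erase _ _ (Finset.mem_univ v),
    ← Finset.add_sum_erase _ (fun v' => m.flip v v' * (f v' - f v)) (Finset.mem_univ v)]
  have h : ∑ x ∈ Finset.univ.erase v, m.flipMatrix v x * f x =
      ∑ x ∈ Finset.univ.erase v, m.flip v x * f x :=
    Finset.sum_congr rfl fun x hx => by
      rw [flipMatrix, if_neg (Finset.ne_of_mem_erase hx).symm]
  rw [h]
  simp only [flipMatrix, if_true, mul_sub, Finset.sum_sub_distrib, Finset.sum_mul, neg_mul]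
  ring

/-- `Γ(α) = ∑_z p(z) (exp ⟨α, z⟩ - 1)`. -/
def jumpCumulant (α : EuclideanSpace ℝ (Fin d)) : ℝ :=
  ∑' z : IntLattice d, m.p z * (Real.exp (inner ℝ α (latticeVec z)) - 1)

/-- `ψ_α(v) = kap * Γ(α) + lam * (exp ⟨α, v⟩ - 1)`. -/
def potential (α : EuclideanSpace ℝ (Fin d)) (v : m.V) : ℝ :=
  m.kap * m.jumpCumulant α + m.lam * (Real.exp (inner ℝ α (latticeVec (v : IntLattice d))) - 1)

/-- `M(α) = gam * A + diag ψ_α`. -/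
def tiltedMatrix (α : EuclideanSpace ℝ (Fin d)) : Matrix m.V m.V ℝ :=
  m.gam • m.flipMatrix + Matrix.diagonal (m.potential α)

/-- The Donsker-Varadhan rate function `I_A(μ) = - inf_{f > 0} ∫ (A f / f) dμ`. The infimum is over
a non-empty set of reals, bounded below by `-∑_v μ(v) ∑_{v' ≠ v} flip v v'` for every
probability vector `μ`. -/
def donskerVaradhan (μ : m.V → ℝ) : ℝ :=
  -⨅ f : {f : m.V → ℝ // ∀ v, 0 < f v}, ∑ v : m.V, (m.flipGen f.1 v / f.1 v) * μ v

theorem bddBelow_donskerVaradhan (μ : m.V → ℝ) (hμ : μ ∈ stdSimplex ℝ m.V) :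
    BddBelow (Set.range fun f : {f : m.V → ℝ // ∀ v, 0 < f v} =>
      ∑ v : m.V, (m.flipGen f.1 v / f.1 v) * μ v) := by
  refine ⟨∑ v : m.V, m.flipMatrix v v * μ v, ?_⟩
  rintro _ ⟨f, rfl⟩
  refine Finset.sum_le_sum fun v _ => mul_le_mul_of_nonneg_right ?_ (hμ.1 v)
  rw [le_div_iff₀ (f.2 v), ← m.flipMatrix_mulVec]
  simp only [Matrix.mulVec, dotProduct]
  rw [← Finset.add_sum_erase _ _ (Finset.mem_univ v)]
  refine le_add_of_nonneg_right (Finset.sum_nonneg fun x hx => ?_)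
  have hne := (Finset.ne_of_mem_erase hx).symm
  rw [flipMatrix, if_neg hne]
  exact mul_nonneg (m.flip_nonneg v x hne) (f.2 x).le

end ActiveParticleModel

/-- The large deviation principle with speed `t`, as `t → ∞`, for the family `Y t` of random
elements of `E`, with the good rate function `I`. -/
structure SatisfiesLDP {Ω E : Type*} [MeasurableSpace Ω] [TopologicalSpace E] (P : Measure Ω)
    (Y : ℝ≥0 → Ω → E) (I : E → EReal) : Prop where
  nonneg : ∀ x, 0 ≤ I x
  lowerSemicontinuous : LowerSemicontinuous I
  compact_sublevel : ∀ c : ℝ, IsCompact {x | I x ≤ (c : EReal)}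
  upper_bound : ∀ B : Set E, IsClosed B →
    limsup (fun t : ℝ≥0 => (((t : ℝ)⁻¹ : ℝ) : EReal) * ENNReal.log (P {ω | Y t ω ∈ B})) atTop
      ≤ -(⨅ x ∈ B, I x)
  lower_bound : ∀ G : Set E, IsOpen G →
    -(⨅ x ∈ G, I x) ≤
      liminf (fun t : ℝ≥0 => (((t : ℝ)⁻¹ : ℝ) : EReal) * ENNReal.log (P {ω | Y t ω ∈ G})) atTop

/-- The Legendre transform `x ↦ sup_α (⟨α, x⟩ - F α)`, with values in the extended reals. -/
def legendreTransform {d : ℕ} (F : EuclideanSpace ℝ (Fin d) → ℝ)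
    (x : EuclideanSpace ℝ (Fin d)) : EReal :=
  ⨆ α : EuclideanSpace ℝ (Fin d), ((inner ℝ α x - F α : ℝ) : EReal)

end

/-! The matrix `M(α)` is irreducible with nonnegative off-diagonal entries, so it has a Perron
eigenvalue `F(α)` with positive right and left eigenvectors `r` and `l`
(`IsMetzlerIrreducible.exists_isPerronTriple`). Since `L` acts on `exp ⟨α, x⟩ r(v)` through `M(α)`,
this function is a positive eigenfunction of `L`. As `r` is bounded above and away from zero on the
finite set `V`, the exponential moment of `X_t` should lie between two constant multiples of `exp (t
F(α))`.

The eigenfunction is unbounded, while the semigroup acts on bounded functions only. The bridge is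
`le_semigroup_of_eigenfunctions`: `L` plus a large constant preserves order, so a combination of
eigenfunctions below a bounded `f` stays below it along the exponential series. Truncation then
gives the upper moment bound. For the lower one, a small multiple of the eigenfunction for `2α` is
subtracted; it dominates the square of the first, so the difference is bounded above. The outcome is
`exists_moment_bounds`, which also identifies the limit.

In the variational formula, testing with `f = r` bounds every value by `F(α)`, and `e^u ≥ 1 + u`
gives equality at the measure proportional to `l r` (`IsPerronTriple.le_sum_mulVec_div`). For
symmetric rates the supremum is that of a quadratic form, attained at the measure proportional to
`r²`.

The large deviation principle is a Gärtner-Ellis argument. Pairing the left eigenvector of one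
matrix with the right eigenvector of another makes `F` continuous and differentiable along lines
(`IsPerronTriple.sub_mul_eq`). Chernoff bounds on finitely many half-spaces give the upper bound.
For the lower bound, points of finite rate are approximated by gradients of `F`, where the
exponentially tilted law concentrates. -/

/-! ### Perron's theorem for irreducible Metzler matrices. -/

/-- A square matrix with nonnegative off-diagonal entries whose graph is strongly connected. -/
structure IsMetzlerIrreducible {ι : Type*} (M : Matrix ι ι ℝ) : Prop where
  offDiag_nonneg : ∀ i j, i ≠ j → 0 ≤ M i j
  irreducible : ∀ i j, Relation.ReflTransGen (fun a b => a ≠ b ∧ 0 < M a b) i j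

namespace IsMetzlerIrreducible

variable {ι : Type*} {M : Matrix ι ι ℝ}

theorem transpose (hM : IsMetzlerIrreducible M) : IsMetzlerIrreducible M.transpose where
  offDiag_nonneg i j h := hM.offDiag_nonneg j i h.symm
  irreducible i j := by
    have h := Relation.reflTransGen_swap.2 (hM.irreducible j i)
    exact Relation.ReflTransGen.mono (fun a b hab => ⟨hab.1.symm, hab.2⟩) _ _ h

theorem add_diagonal [DecidableEq ι] (hM : IsMetzlerIrreducible M) (f : ι → ℝ) :
    IsMetzlerIrreducible (M + Matrix.diagonal f) where
  offDiag_nonneg i j h := by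
    simpa [Matrix.diagonal_apply_ne f h] using hM.offDiag_nonneg i j h
  irreducible i j := by
    refine Relation.ReflTransGen.mono (fun a b hab => ?_) _ _ (hM.irreducible i j)
    simpa [Matrix.diagonal_apply_ne f hab.1, hab.1] using hab.2

theorem mulVec_pos_of_pos [Fintype ι] {E : Matrix ι ι ℝ} (hE : ∀ i j, 0 < E i j) {x : ι → ℝ}
    (hx : ∀ i, 0 ≤ x i) (hx0 : x ≠ 0) (i : ι) : 0 < E.mulVec x i := by
  obtain ⟨j, hj⟩ := Function.ne_iff.1 hx0
  exact Finset.sum_pos' (fun j _ => mul_nonneg (hE i j).le (hx j))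
    ⟨j, Finset.mem_univ j, mul_pos (hE i j) (lt_of_le_of_ne (hx j) (Ne.symm hj))⟩

variable [Fintype ι] [DecidableEq ι]

/-- A shift of an irreducible Metzler matrix by a multiple of the identity is nonnegative and has a
positive power. -/
theorem exists_shift_pow_pos (hM : IsMetzlerIrreducible M) :
    ∃ c : ℝ, ∃ N : ℕ, (∀ i j, 0 ≤ (M + c • (1 : Matrix ι ι ℝ)) i j) ∧
      ∀ i j, 0 < ((M + c • (1 : Matrix ι ι ℝ)) ^ N) i j := by
  -- This shift makes every diagonal entry strictly positive, so that positivity of an entry of a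
  -- power persists in all higher powers.
  set c : ℝ := 1 + ∑ i, |M i i| with hc
  set B := M + c • (1 : Matrix ι ι ℝ) with hB
  have hdiag : ∀ i, 0 < B i i := fun i => by
    have h1 : |M i i| ≤ ∑ i, |M i i| :=
      Finset.single_le_sum (f := fun i => |M i i|) (fun i _ => abs_nonneg _) (Finset.mem_univ i)
    have h2 := neg_abs_le (M i i)
    simp only [hB, Matrix.add_apply, Matrix.smul_apply, Matrix.one_apply_eq, smul_eq_mul, mul_one]
    linarith
  have hoff : ∀ i j, i ≠ j → B i j = M i j := fun i j h => by
    simp [hB, Matrix.one_apply_ne h]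
  have hnn : ∀ i j, 0 ≤ B i j := fun i j => by
    by_cases h : i = j
    · subst h; exact (hdiag i).le
    · rw [hoff i j h]; exact hM.offDiag_nonneg i j h
  have hpow : ∀ k i j, 0 ≤ (B ^ k) i j := by
    intro k
    induction k with
    | zero => intro i j; rw [pow_zero, Matrix.one_apply]; split_ifs <;> norm_num
    | succ k ih =>
      intro i j
      rw [pow_succ, Matrix.mul_apply]
      exact Finset.sum_nonneg fun x _ => mul_nonneg (ih i x) (hnn x j)
  have hstep : ∀ k i a b, 0 < (B ^ k) i a → 0 < B a b → 0 < (B ^ (k + 1)) i b := by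
    intro k i a b h1 h2
    rw [pow_succ, Matrix.mul_apply]
    exact Finset.sum_pos' (fun x _ => mul_nonneg (hpow k i x) (hnn x b))
      ⟨a, Finset.mem_univ a, mul_pos h1 h2⟩
  have hmono : ∀ i j k l, k ≤ l → 0 < (B ^ k) i j → 0 < (B ^ l) i j := by
    intro i j k l hkl h
    induction l, hkl using Nat.le_induction with
    | base => exact h
    | succ l _ ih => exact hstep l i j j ih (hdiag j)
  have hex : ∀ i j, ∃ k, 0 < (B ^ k) i j := by
    intro i j
    induction hM.irreducible i j with
    | refl => exact ⟨0, by simp⟩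
    | tail _ hbc ih =>
      obtain ⟨k, hk⟩ := ih
      exact ⟨k + 1, hstep k i _ _ hk (by rw [hoff _ _ hbc.1]; exact hbc.2)⟩
  choose k hk using hex
  -- The sum is a common upper bound of all the exponents `k i j`.
  refine ⟨c, ∑ i, ∑ j, k i j, hnn, fun i j => hmono i j _ _ ?_ (hk i j)⟩
  calc k i j ≤ ∑ j, k i j :=
        Finset.single_le_sum (f := fun j => k i j) (fun _ _ => Nat.zero_le _) (Finset.mem_univ j)
    _ ≤ _ := Finset.single_le_sum (f := fun i => ∑ j, k i j) (fun _ _ => Nat.zero_le _)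
        (Finset.mem_univ i)

theorem pow_mulVec_of_mulVec_eq {B : Matrix ι ι ℝ} {x : ι → ℝ} {c : ℝ}
    (h : B.mulVec x = c • x) (N : ℕ) : (B ^ N).mulVec x = c ^ N • x := by
  induction N with
  | zero => simp
  | succ N ih =>
    rw [pow_succ, ← Matrix.mulVec_mulVec, h, Matrix.mulVec_smul, ih, smul_smul, pow_succ, mul_comm]

/-- A nonzero nonnegative eigenvector of an irreducible Metzler matrix is positive. -/
theorem pos_of_eigenvector (hM : IsMetzlerIrreducible M) {x : ι → ℝ} {Λ : ℝ}
    (h : M.mulVec x = Λ • x) (hx : ∀ i, 0 ≤ x i) (hx0 : x ≠ 0) (i : ι) : 0 < x i := by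
  obtain ⟨c, N, -, hN⟩ := hM.exists_shift_pow_pos
  have h' : (M + c • (1 : Matrix ι ι ℝ)).mulVec x = (Λ + c) • x := by
    rw [Matrix.add_mulVec, h, Matrix.smul_mulVec, Matrix.one_mulVec, add_smul]
  -- The positive power sends `x` to a strictly positive vector, yet only multiplies it by `(Λ + c)
  -- ^ N`; hence no entry of `x` vanishes.
  have h1 := mulVec_pos_of_pos hN hx hx0 i
  rw [pow_mulVec_of_mulVec_eq h', Pi.smul_apply, smul_eq_mul] at h1
  rcases (hx i).lt_or_eq with h2 | h2
  · exact h2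
  · rw [← h2, mul_zero] at h1
    exact absurd h1 (lt_irrefl _)

/-- The eigenspace which contains a positive eigenvector is one-dimensional. -/
theorem eq_smul_of_eigenvector [Nonempty ι] (hM : IsMetzlerIrreducible M) {r x : ι → ℝ} {Λ : ℝ}
    (hr : ∀ i, 0 < r i) (hMr : M.mulVec r = Λ • r) (hMx : M.mulVec x = Λ • x) :
    ∃ k : ℝ, x = k • r := by
  -- Subtracting the largest multiple of `r` below `x` leaves a nonnegative eigenvector that
  -- vanishes at `i₀`. Were it nonzero, it would have to be positive there.
  obtain ⟨i₀, hi₀⟩ := Finite.exists_min fun i => x i / r i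
  refine ⟨x i₀ / r i₀, ?_⟩
  by_contra hne
  have hy0 : x - (x i₀ / r i₀) • r ≠ 0 := sub_ne_zero.2 hne
  have hMy : M.mulVec (x - (x i₀ / r i₀) • r) = Λ • (x - (x i₀ / r i₀) • r) := by
    rw [Matrix.mulVec_sub, Matrix.mulVec_smul, hMr, hMx, smul_sub, smul_comm]
  have h := hM.pos_of_eigenvector hMy (fun i => ?_) hy0 i₀
  · simp [div_mul_cancel₀ _ (hr i₀).ne'] at h
  · have := (le_div_iff₀ (hr i)).1 (hi₀ i)
    simpa using this

/-- **Perron's theorem**: an irreducible Metzler matrix has a positive eigenvector. -/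
theorem exists_pos_eigenvector [Nonempty ι] (hM : IsMetzlerIrreducible M) :
    ∃ (Λ : ℝ) (r : ι → ℝ), (∀ i, 0 < r i) ∧ M.mulVec r = Λ • r := by
  obtain ⟨c, N, hnn, hN⟩ := hM.exists_shift_pow_pos
  set B := M + c • (1 : Matrix ι ι ℝ) with hB
  set R := ∑ i, ∑ j, B i j
  have hR : ∀ x ∈ stdSimplex ℝ ι, ∀ ρ : ℝ, (∀ i, ρ * x i ≤ B.mulVec x i) → ρ ≤ R := by
    intro x hx ρ h
    calc ρ = ∑ i, ρ * x i := by rw [← Finset.mul_sum, hx.2, mul_one]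
      _ ≤ ∑ i, B.mulVec x i := Finset.sum_le_sum fun i _ => h i
      _ ≤ R := Finset.sum_le_sum fun i _ => Finset.sum_le_sum fun j _ => by
          refine mul_le_of_le_one_right (hnn i j) ?_
          rw [← hx.2]
          exact Finset.single_le_sum (fun k _ => hx.1 k) (Finset.mem_univ j)
  -- Collatz-Wielandt: the Perron root of `B` is the largest `ρ` with `ρ x ≤ B x` for some `x` in
  -- the simplex. The bound `R` makes the set of pairs compact, so a maximiser exists.
  set S : Set ((ι → ℝ) × ℝ) := (stdSimplex ℝ ι ×ˢ Set.Icc 0 R) ∩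
    {p | ∀ i, p.2 * p.1 i ≤ B.mulVec p.1 i} with hS
  have hScpt : IsCompact S := by
    refine ((isCompact_stdSimplex ℝ ι).prod isCompact_Icc).inter_right ?_
    simp only [Set.ofPred_forall]
    refine isClosed_iInter fun i => isClosed_le (by fun_prop) ?_
    simp only [Matrix.mulVec, dotProduct]
    fun_prop
  have hSne : S.Nonempty := by
    obtain ⟨i₀⟩ := ‹Nonempty ι›
    refine ⟨(Pi.single i₀ 1, 0), ⟨single_mem_stdSimplex ℝ i₀, le_rfl, ?_⟩, fun i => ?_⟩
    · exact Finset.sum_nonneg fun i _ => Finset.sum_nonneg fun j _ => hnn i j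
    · simp only [zero_mul, Matrix.mulVec_single_one]
      exact hnn _ _
  obtain ⟨⟨x, ρ⟩, ⟨⟨hx, hρ⟩, hle⟩, hmax⟩ := hScpt.exists_isMaxOn hSne continuous_snd.continuousOn
  simp only [Set.mem_ofPred_eq] at hx hρ hle
  have hx0 : x ≠ 0 := by
    rintro rfl
    have := hx.2
    simp at this
  -- If `B x - ρ x` were nonzero, `B ^ N` would make it strictly positive; then `y = B ^ N x`, once
  -- normalised, admits the larger value `ρ + ε`, against maximality.
  have hkey : B.mulVec x = ρ • x := by
    by_contra hne
    have hw0 : B.mulVec x - ρ • x ≠ 0 := sub_ne_zero.2 hne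
    have hEw := mulVec_pos_of_pos hN (x := B.mulVec x - ρ • x)
      (fun i => by simpa using hle i) hw0
    have hEx := mulVec_pos_of_pos hN hx.1 hx0
    set y := (B ^ N).mulVec x with hy
    have hBy : (B ^ N).mulVec (B.mulVec x - ρ • x) = B.mulVec y - ρ • y := by
      rw [Matrix.mulVec_sub, Matrix.mulVec_smul, hy, Matrix.mulVec_mulVec, Matrix.mulVec_mulVec,
        (Commute.pow_self B N).eq]
    rw [hBy] at hEw
    obtain ⟨i₀, hi₀⟩ := Finite.exists_min fun i => (B.mulVec y - ρ • y) i / y i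
    set ε := (B.mulVec y - ρ • y) i₀ / y i₀
    have hε : 0 < ε := div_pos (hEw i₀) (hEx i₀)
    have hs : 0 < ∑ i, y i := Finset.sum_pos (fun i _ => hEx i) Finset.univ_nonempty
    have hmem : (∑ i, y i)⁻¹ • y ∈ stdSimplex ℝ ι := by
      refine ⟨fun i => mul_nonneg (inv_nonneg.2 hs.le) (hEx i).le, ?_⟩
      simp only [Pi.smul_apply, smul_eq_mul]
      rw [← Finset.mul_sum, inv_mul_cancel₀ hs.ne']
    have hle' : ∀ i, (ρ + ε) * ((∑ i, y i)⁻¹ • y) i ≤ B.mulVec ((∑ i, y i)⁻¹ • y) i := by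
      intro i
      have h1 := (le_div_iff₀ (hEx i)).1 (hi₀ i)
      rw [Matrix.mulVec_smul]
      simp only [Pi.smul_apply, smul_eq_mul, Pi.sub_apply] at h1 ⊢
      rw [mul_left_comm]
      refine mul_le_mul_of_nonneg_left ?_ (inv_nonneg.2 hs.le)
      linarith
    have hin : ((∑ i, y i)⁻¹ • y, ρ + ε) ∈ S :=
      ⟨⟨hmem, by linarith [hρ.1], hR _ hmem _ hle'⟩, hle'⟩
    have := hmax hin
    simp only [Set.mem_ofPred_eq] at this
    linarith
  have hMx : M.mulVec x = (ρ - c) • x := by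
    have : M.mulVec x = B.mulVec x - c • x := by
      rw [hB, Matrix.add_mulVec, Matrix.smul_mulVec, Matrix.one_mulVec, add_sub_cancel_right]
    rw [this, hkey, sub_smul]
  exact ⟨ρ - c, x, hM.pos_of_eigenvector hMx hx.1 hx0, hMx⟩

end IsMetzlerIrreducible

/-! ### Spectral and variational consequences of the two Perron eigenvectors. -/

/-- Perron eigenvalue `Λ`, with a positive right eigenvector `r` and a positive left
eigenvector `l` of total mass one. -/
structure IsPerronTriple {ι : Type*} [Fintype ι] (M : Matrix ι ι ℝ) (Λ : ℝ) (r l : ι → ℝ) :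
    Prop where
  right_pos : ∀ i, 0 < r i
  left_pos : ∀ i, 0 < l i
  left_sum : ∑ i, l i = 1
  mulVec_right : M.mulVec r = Λ • r
  mulVec_left : M.transpose.mulVec l = Λ • l

theorem sum_mul_mulVec_eq_of_left_eigenvector {ι : Type*} [Fintype ι] {M : Matrix ι ι ℝ}
    {l : ι → ℝ} {Λ : ℝ} (h : M.transpose.mulVec l = Λ • l) (x : ι → ℝ) :
    ∑ i, l i * M.mulVec x i = Λ * ∑ i, l i * x i := by
  have h1 : l ⬝ᵥ M.mulVec x = (Λ • l) ⬝ᵥ x := by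
    rw [Matrix.dotProduct_mulVec, ← Matrix.mulVec_transpose, h]
  simpa [dotProduct, Finset.mul_sum, mul_assoc] using h1

/-- Perron's theorem applies to the matrix and to its transpose. The two eigenvalues agree because
the pairing of the two positive eigenvectors is nonzero. -/
theorem IsMetzlerIrreducible.exists_isPerronTriple {ι : Type*} [Fintype ι] [DecidableEq ι]
    [Nonempty ι] {M : Matrix ι ι ℝ} (hM : IsMetzlerIrreducible M) :
    ∃ (Λ : ℝ) (r l : ι → ℝ), IsPerronTriple M Λ r l := by
  obtain ⟨Λ, r, hr, hMr⟩ := hM.exists_pos_eigenvector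
  obtain ⟨Λ', l, hl, hMl⟩ := hM.transpose.exists_pos_eigenvector
  have hs : 0 < ∑ i, l i := Finset.sum_pos (fun i _ => hl i) Finset.univ_nonempty
  have hlr : 0 < ∑ i, l i * r i :=
    Finset.sum_pos (fun i _ => mul_pos (hl i) (hr i)) Finset.univ_nonempty
  have hΛ : Λ' = Λ := by
    have h1 := sum_mul_mulVec_eq_of_left_eigenvector hMl r
    rw [hMr] at h1
    have h2 : ∑ i, l i * (Λ • r) i = Λ * ∑ i, l i * r i := by
      rw [Finset.mul_sum]
      exact Finset.sum_congr rfl fun i _ => by simp; ring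
    rw [h2] at h1
    exact (mul_right_cancel₀ hlr.ne' h1).symm
  subst hΛ
  refine ⟨Λ', r, (∑ i, l i)⁻¹ • l, hr, fun i => mul_pos (inv_pos.2 hs) (hl i), ?_, hMr, ?_⟩
  · simp only [Pi.smul_apply, smul_eq_mul]
    rw [← Finset.mul_sum, inv_mul_cancel₀ hs.ne']
  · rw [Matrix.mulVec_smul, hMl, smul_comm]

namespace IsPerronTriple

variable {ι : Type*} [Fintype ι] {M : Matrix ι ι ℝ} {Λ : ℝ} {r l : ι → ℝ}

theorem nonempty (h : IsPerronTriple M Λ r l) : Nonempty ι := by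
  by_contra h'
  rw [not_nonempty_iff] at h'
  have := h.left_sum
  simp at this

theorem sum_left_mul_right_pos (h : IsPerronTriple M Λ r l) : 0 < ∑ i, l i * r i :=
  have := h.nonempty
  Finset.sum_pos (fun i _ => mul_pos (h.left_pos i) (h.right_pos i)) Finset.univ_nonempty

theorem mulVec_right_apply (h : IsPerronTriple M Λ r l) (i : ι) :
    ∑ j, M i j * r j = Λ * r i := congrFun h.mulVec_right i

theorem mulVec_left_apply (h : IsPerronTriple M Λ r l) (j : ι) :
    ∑ i, l i * M i j = Λ * l j := by
  have := congrFun h.mulVec_left j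
  simpa [Matrix.mulVec, dotProduct, mul_comm] using this

/-- Ground-state substitution: the difference of the two sides is half the sum of `M i j * r i * r j
* (x i / r i - x j / r j) ^ 2`, in which the diagonal terms vanish. -/
theorem sum_mul_mulVec_le_of_symm (h : IsPerronTriple M Λ r l)
    (hoff : ∀ i j, i ≠ j → 0 ≤ M i j) (hsymm : ∀ i j, M i j = M j i) (x : ι → ℝ) :
    ∑ i, ∑ j, x i * x j * M i j ≤ Λ * ∑ i, x i ^ 2 := by
  have hterm : ∀ i j, x i * x j * M i j ≤
      (x i ^ 2 / r i * (M i j * r j) + x j ^ 2 / r j * (M j i * r i)) / 2 := by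
    intro i j
    have hri := h.right_pos i; have hrj := h.right_pos j
    by_cases hij : i = j
    · subst hij
      apply le_of_eq; field_simp; ring
    · have h1 : (x i ^ 2 / r i * (M i j * r j) + x j ^ 2 / r j * (M j i * r i)) / 2 -
          x i * x j * M i j = M i j * (r i * r j) * (x i / r i - x j / r j) ^ 2 / 2 := by
        rw [hsymm j i]; field_simp; ring
      have h2 : 0 ≤ M i j * (r i * r j) * (x i / r i - x j / r j) ^ 2 / 2 := by
        have := hoff i j hij
        positivity
      linarith
  have hS : ∑ i, ∑ j, x i ^ 2 / r i * (M i j * r j) = Λ * ∑ i, x i ^ 2 := by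
    rw [Finset.mul_sum]
    refine Finset.sum_congr rfl fun i _ => ?_
    rw [← Finset.mul_sum, h.mulVec_right_apply]
    have := (h.right_pos i).ne'
    field_simp
  have hS' : ∑ i, ∑ j, x j ^ 2 / r j * (M j i * r i) = Λ * ∑ i, x i ^ 2 := by
    rw [Finset.sum_comm, hS]
  calc ∑ i, ∑ j, x i * x j * M i j ≤ ∑ i, ∑ j,
        (x i ^ 2 / r i * (M i j * r j) + x j ^ 2 / r j * (M j i * r i)) / 2 :=
        Finset.sum_le_sum fun i _ => Finset.sum_le_sum fun j _ => hterm i j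
    _ = Λ * ∑ i, x i ^ 2 := by
        simp only [← Finset.sum_div, Finset.sum_add_distrib]
        rw [hS, hS']; ring

variable [DecidableEq ι]

theorem hasEigenvalue (h : IsPerronTriple M Λ r l) :
    Module.End.HasEigenvalue (Matrix.toLin' M) Λ := by
  obtain ⟨i⟩ := h.nonempty
  refine Module.End.hasEigenvalue_of_hasEigenvector (x := r)
    ⟨Module.End.mem_eigenspace_iff.2 (by rw [Matrix.toLin'_apply, h.mulVec_right]), ?_⟩
  exact fun h0 => (h.right_pos i).ne' (congrFun h0 i)

/-- Moduli in the eigenvalue equation of the nonnegative shifted matrix give a real inequality for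
the vector of `‖u i‖`; pairing it with the positive left eigenvector compares `z.re` with `Λ`. -/
theorem re_le_of_hasEigenvalue (h : IsPerronTriple M Λ r l) (hM : IsMetzlerIrreducible M) {z : ℂ}
    (hz : Module.End.HasEigenvalue (Matrix.toLin' (M.map (fun r : ℝ => (r : ℂ)))) z) :
    z.re ≤ Λ := by
  obtain ⟨u, hu, hu0⟩ := hz.exists_hasEigenvector
  rw [Module.End.mem_eigenspace_iff, Matrix.toLin'_apply] at hu
  obtain ⟨c, -, hnn, -⟩ := hM.exists_shift_pow_pos
  have hle : ∀ i, (z.re + c) * ‖u i‖ ≤ M.mulVec (fun i => ‖u i‖) i + c * ‖u i‖ := by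
    intro i
    have h1 : (z + c) * u i = ∑ j, ((M + c • (1 : Matrix ι ι ℝ)) i j : ℂ) * u j := by
      have h2 := congrFun hu i
      simp only [Matrix.mulVec, dotProduct, Matrix.map_apply, Pi.smul_apply, smul_eq_mul] at h2
      have h4 : ∀ j, ((M + c • (1 : Matrix ι ι ℝ)) i j : ℂ) * u j =
          M i j * u j + if i = j then c * u j else 0 := fun j => by
        split_ifs with hij <;> simp [hij, add_mul]
      simp only [h4]
      simp [ Finset.sum_add_distrib, h2, add_mul]
    have h3 : ∑ j, (M + c • (1 : Matrix ι ι ℝ)) i j * ‖u j‖ =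
        M.mulVec (fun i => ‖u i‖) i + c * ‖u i‖ := by
      simp [add_mul, Finset.sum_add_distrib, Matrix.one_apply, Matrix.mulVec, dotProduct]
    calc (z.re + c) * ‖u i‖ ≤ ‖z + c‖ * ‖u i‖ := by
          refine mul_le_mul_of_nonneg_right ?_ (norm_nonneg _)
          simpa using Complex.re_le_norm (z + c)
      _ = ‖∑ j, ((M + c • (1 : Matrix ι ι ℝ)) i j : ℂ) * u j‖ := by rw [← norm_mul, h1]
      _ ≤ ∑ j, (M + c • (1 : Matrix ι ι ℝ)) i j * ‖u j‖ := by
          refine (norm_sum_le _ _).trans_eq (Finset.sum_congr rfl fun j _ => ?_)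
          rw [norm_mul, Complex.norm_real, Real.norm_of_nonneg (hnn i j)]
      _ = _ := h3
  have hsum : z.re * ∑ i, l i * ‖u i‖ ≤ Λ * ∑ i, l i * ‖u i‖ := by
    rw [← sum_mul_mulVec_eq_of_left_eigenvector h.mulVec_left (fun i => ‖u i‖), Finset.mul_sum]
    refine Finset.sum_le_sum fun i _ => ?_
    have := mul_le_mul_of_nonneg_left (hle i) (h.left_pos i).le
    linarith
  obtain ⟨i, hi⟩ := Function.ne_iff.1 hu0
  refine le_of_mul_le_mul_right hsum ?_
  exact Finset.sum_pos' (fun j _ => mul_nonneg (h.left_pos j).le (norm_nonneg _))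
    ⟨i, Finset.mem_univ i, mul_pos (h.left_pos i) (norm_pos_iff.2 hi)⟩

/-- The Donsker-Varadhan functional, at the product of the Perron eigenvectors, is bounded below
by the Perron eigenvalue. -/
theorem le_sum_mulVec_div (h : IsPerronTriple M Λ r l) (hM : IsMetzlerIrreducible M) {f : ι → ℝ}
    (hf : ∀ i, 0 < f i) :
    Λ * ∑ i, l i * r i ≤ ∑ i, M.mulVec f i / f i * (l i * r i) := by
  -- Each summand is `l i * M i j * r j * exp (g j - g i)`, bounded below through `e^u ≥ 1 + u`; on
  -- the diagonal, where the sign of `M i i` is unknown, there is equality. Row and column sums of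
  -- the weights `l i * M i j * r j` are both `Λ * l i * r i`, so the terms linear in `g` cancel.
  set g : ι → ℝ := fun i => Real.log (f i / r i)
  have hterm : ∀ i j, l i * M i j * r j * (1 + g j - g i) ≤ M i j * f j / f i * (l i * r i) := by
    intro i j
    have hfi := hf i; have hfj := hf j; have hri := h.right_pos i; have hrj := h.right_pos j
    have hli := h.left_pos i
    by_cases hij : i = j
    · subst hij
      rw [mul_div_cancel_right₀ _ hfi.ne']
      apply le_of_eq; ring
    · have h1 : g j - g i ≤ (f j / r j) / (f i / r i) - 1 := by
        rw [← Real.log_div (div_pos hfj hrj).ne' (div_pos hfi hri).ne']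
        exact Real.log_le_sub_one_of_pos (div_pos (div_pos hfj hrj) (div_pos hfi hri))
      have h2 : M i j * f j / f i * (l i * r i) =
          l i * M i j * r j * ((f j / r j) / (f i / r i)) := by
        field_simp
      rw [h2]
      refine mul_le_mul_of_nonneg_left (by linarith) ?_
      exact mul_nonneg (mul_nonneg hli.le (hM.offDiag_nonneg i j hij)) hrj.le
  have hR : ∑ i, M.mulVec f i / f i * (l i * r i) =
      ∑ i, ∑ j, M i j * f j / f i * (l i * r i) := by
    refine Finset.sum_congr rfl fun i _ => ?_
    simp only [Matrix.mulVec, dotProduct]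
    rw [Finset.sum_div, Finset.sum_mul]
  have h1 : ∀ a : ι → ℝ, ∑ i, ∑ j, l i * M i j * r j * a i = Λ * ∑ i, l i * r i * a i := by
    intro a
    rw [Finset.mul_sum]
    refine Finset.sum_congr rfl fun i _ => ?_
    calc ∑ j, l i * M i j * r j * a i = l i * a i * ∑ j, M i j * r j := by
          rw [Finset.mul_sum]; exact Finset.sum_congr rfl fun j _ => by ring
      _ = _ := by rw [h.mulVec_right_apply]; ring
  have h2 : ∀ a : ι → ℝ, ∑ i, ∑ j, l i * M i j * r j * a j = Λ * ∑ i, l i * r i * a i := by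
    intro a
    rw [Finset.sum_comm, Finset.mul_sum]
    refine Finset.sum_congr rfl fun j _ => ?_
    calc ∑ i, l i * M i j * r j * a j = r j * a j * ∑ i, l i * M i j := by
          rw [Finset.mul_sum]; exact Finset.sum_congr rfl fun j _ => by ring
      _ = _ := by rw [h.mulVec_left_apply]; ring
  rw [hR]
  refine le_trans (le_of_eq ?_) (Finset.sum_le_sum fun i _ => Finset.sum_le_sum fun j _ =>
    hterm i j)
  have h3 : ∀ i j, l i * M i j * r j * (1 + g j - g i) =
      l i * M i j * r j * (fun _ => (1 : ℝ)) i + l i * M i j * r j * g j -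
        l i * M i j * r j * g i := fun i j => by ring
  simp only [h3, Finset.sum_sub_distrib, Finset.sum_add_distrib]
  rw [h1 g, h2 g]
  simp only [mul_one]
  have := h1 fun _ => 1
  simp only [mul_one] at this
  rw [this]; ring

/-- The difference of Perron eigenvalues under a change of the diagonal is a weighted mean of the
change. -/
theorem sub_mul_eq {A : Matrix ι ι ℝ} {ψ ψ' : ι → ℝ} {Λ' : ℝ} {r' l' : ι → ℝ}
    (h : IsPerronTriple (A + Matrix.diagonal ψ) Λ r l)
    (h' : IsPerronTriple (A + Matrix.diagonal ψ') Λ' r' l') :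
    (Λ' - Λ) * ∑ i, l' i * r i = ∑ i, l' i * r i * (ψ' i - ψ i) := by
  -- The pairing of `l'` with the second matrix applied to `r` is computed twice: by the left
  -- eigenvalue equation, and by the right equation of the first matrix plus the diagonal
  -- correction.
  have h1 := sum_mul_mulVec_eq_of_left_eigenvector h'.mulVec_left r
  have h2 : ∀ i, (A + Matrix.diagonal ψ').mulVec r i = Λ * r i + (ψ' i - ψ i) * r i := by
    intro i
    have h3 := congrFun h.mulVec_right i
    simp only [Matrix.add_mulVec, Pi.add_apply, Matrix.mulVec_diagonal, Pi.smul_apply,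
      smul_eq_mul] at h3 ⊢
    linarith
  rw [sub_mul, ← h1, Finset.mul_sum, ← Finset.sum_sub_distrib]
  refine Finset.sum_congr rfl fun i _ => ?_
  rw [h2]; ring

/-- The weights in `sub_mul_eq` are positive, and a weighted mean is at most the sup norm. This
supplies continuity of the eigenvalue in the diagonal. -/
theorem abs_sub_le {A : Matrix ι ι ℝ} {ψ ψ' : ι → ℝ} {Λ' : ℝ} {r' l' : ι → ℝ}
    (h : IsPerronTriple (A + Matrix.diagonal ψ) Λ r l)
    (h' : IsPerronTriple (A + Matrix.diagonal ψ') Λ' r' l') :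
    |Λ' - Λ| ≤ ‖ψ' - ψ‖ := by
  have := h.nonempty
  have hpos : 0 < ∑ i, l' i * r i :=
    Finset.sum_pos (fun i _ => mul_pos (h'.left_pos i) (h.right_pos i)) Finset.univ_nonempty
  refine le_of_mul_le_mul_right ?_ hpos
  rw [← abs_of_pos hpos, ← abs_mul, h.sub_mul_eq h', abs_of_pos hpos, Finset.mul_sum]
  refine (Finset.abs_sum_le_sum_abs _ _).trans (Finset.sum_le_sum fun i _ => ?_)
  have h1 := mul_pos (h'.left_pos i) (h.right_pos i)
  rw [abs_mul, abs_of_pos h1, mul_comm]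
  exact mul_le_mul_of_nonneg_right (norm_le_pi_norm (ψ' - ψ) i) h1.le

end IsPerronTriple

/-! ### Regularity of the Perron data under a change of the diagonal. -/

/-- The left Perron eigenvector depends continuously on the diagonal. -/
theorem tendsto_left_of_isPerronTriple {ι : Type*} [Fintype ι] [DecidableEq ι]
    {A : Matrix ι ι ℝ} (hA : IsMetzlerIrreducible A) {ψ : ℝ → ι → ℝ} {Λ : ℝ → ℝ} {r l : ℝ → ι → ℝ}
    (h : ∀ s, IsPerronTriple (A + Matrix.diagonal (ψ s)) (Λ s) (r s) (l s)) {s₀ : ℝ}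
    (hψ : ContinuousAt ψ s₀) : Tendsto l (𝓝 s₀) (𝓝 (l s₀)) := by
  have := (h s₀).nonempty
  have hΛ : Tendsto Λ (𝓝 s₀) (𝓝 (Λ s₀)) := by
    rw [tendsto_iff_dist_tendsto_zero]
    refine squeeze_zero (fun _ => dist_nonneg) (fun s => (h s₀).abs_sub_le (h s)) ?_
    have := (tendsto_iff_norm_sub_tendsto_zero.1 hψ)
    exact this
  -- Any cluster point in the simplex solves the limiting left eigenvalue equation, whose solutions
  -- form a line; total mass one then singles out `l s₀`.
  refine (isCompact_stdSimplex ℝ ι).tendsto_nhds_of_unique_mapClusterPt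
    (Eventually.of_forall fun s => ⟨fun i => ((h s).left_pos i).le, (h s).left_sum⟩) ?_
  intro y hy hcl
  have hM := (hA.add_diagonal (ψ s₀)).transpose
  have hG : ∀ s, (A + Matrix.diagonal (ψ s₀)).transpose.mulVec (l s) - Λ s₀ • l s =
      fun i => (ψ s₀ i - ψ s i + (Λ s - Λ s₀)) * l s i := by
    intro s
    ext i
    have h1 := congrFun (h s).mulVec_left i
    simp only [Matrix.transpose_add, Matrix.diagonal_transpose, Matrix.add_mulVec, Pi.add_apply,
      Matrix.mulVec_diagonal, Pi.smul_apply, smul_eq_mul, Pi.sub_apply] at h1 ⊢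
    linarith
  have hG0 : Tendsto (fun s => (A + Matrix.diagonal (ψ s₀)).transpose.mulVec (l s) - Λ s₀ • l s)
      (𝓝 s₀) (𝓝 0) := by
    rw [funext hG]
    refine tendsto_pi_nhds.2 fun i => ?_
    have hψi := (tendsto_pi_nhds.1 hψ) i
    have h1 : Tendsto (fun s => ψ s₀ i - ψ s i + (Λ s - Λ s₀)) (𝓝 s₀) (𝓝 0) := by
      have := (tendsto_const_nhds (x := ψ s₀ i)).sub hψi |>.add (hΛ.sub_const (Λ s₀))
      simpa using this
    refine squeeze_zero_norm (fun s => ?_) (tendsto_zero_iff_norm_tendsto_zero.1 h1)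
    rw [norm_mul]
    refine mul_le_of_le_one_right (norm_nonneg _) ?_
    rw [Real.norm_of_nonneg ((h s).left_pos i).le, ← (h s).left_sum]
    exact Finset.single_le_sum (fun k _ => ((h s).left_pos k).le) (Finset.mem_univ i)
  have hcont : Continuous fun x : ι → ℝ =>
      (A + Matrix.diagonal (ψ s₀)).transpose.mulVec x - Λ s₀ • x := by
    exact (continuous_const.matrix_mulVec continuous_id).sub (continuous_const_smul _)
  have hcl' := hcl.continuousAt_comp hcont.continuousAt
  have hy0 : (A + Matrix.diagonal (ψ s₀)).transpose.mulVec y - Λ s₀ • y = 0 :=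
    have : (𝓝 ((A + Matrix.diagonal (ψ s₀)).transpose.mulVec y - Λ s₀ • y) ⊓
        𝓝 (0 : ι → ℝ)).NeBot := NeBot.mono hcl' (inf_le_inf_left _ hG0)
    eq_of_nhds_neBot this
  obtain ⟨k, hk⟩ := hM.eq_smul_of_eigenvector (h s₀).left_pos (h s₀).mulVec_left (sub_eq_zero.1 hy0)
  have hk1 : k = 1 := by
    have h1 := hy.2
    rw [hk] at h1
    simpa [← Finset.mul_sum, (h s₀).left_sum] using h1
  rw [hk, hk1, one_smul]

/-- The Perron eigenvalue is differentiable along differentiable curves of diagonals. -/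
theorem differentiableAt_of_isPerronTriple {ι : Type*} [Fintype ι] [DecidableEq ι]
    {A : Matrix ι ι ℝ} (hA : IsMetzlerIrreducible A) {ψ : ℝ → ι → ℝ} {Λ : ℝ → ℝ} {r l : ℝ → ι → ℝ}
    (h : ∀ s, IsPerronTriple (A + Matrix.diagonal (ψ s)) (Λ s) (r s) (l s)) {s₀ : ℝ}
    (hψ : ∀ i, DifferentiableAt ℝ (fun s => ψ s i) s₀) : DifferentiableAt ℝ Λ s₀ := by
  have := (h s₀).nonempty
  have hcont : ContinuousAt ψ s₀ := continuousAt_pi.2 fun i => (hψ i).continuousAt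
  have hl := tendsto_pi_nhds.1 (tendsto_left_of_isPerronTriple hA h hcont)
  have hpos : ∀ s, 0 < ∑ i, l s i * r s₀ i := fun s =>
    Finset.sum_pos (fun i _ => mul_pos ((h s).left_pos i) ((h s₀).right_pos i))
      Finset.univ_nonempty
  -- By `sub_mul_eq` the slope of `Λ` is a weighted mean of the slopes of `ψ`. The right eigenvector
  -- stays frozen at `s₀`, so only continuity of `l` is needed in the limit.
  have hslope : ∀ s, slope Λ s₀ s =
      (∑ i, l s i * r s₀ i * slope (fun s => ψ s i) s₀ s) / ∑ i, l s i * r s₀ i := by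
    intro s
    rw [eq_div_iff (hpos s).ne']
    simp only [slope_def_field]
    rw [div_mul_eq_mul_div, (h s₀).sub_mul_eq (h s), Finset.sum_div]
    exact Finset.sum_congr rfl fun i _ => by ring
  have : HasDerivAt Λ ((∑ i, l s₀ i * r s₀ i * deriv (fun s => ψ s i) s₀) /
      ∑ i, l s₀ i * r s₀ i) s₀ := by
    rw [hasDerivAt_iff_tendsto_slope]
    simp only [funext hslope]
    refine Tendsto.div ?_ ?_ (hpos s₀).ne'
    · refine tendsto_finsetSum _ fun i _ => ?_
      exact (((hl i).mono_left nhdsWithin_le_nhds).mul_const _).mul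
        (hasDerivAt_iff_tendsto_slope.1 (hψ i).hasDerivAt)
    · exact tendsto_finsetSum _ fun i _ => ((hl i).mono_left nhdsWithin_le_nhds).mul_const _
  exact this.differentiableAt

/-! ### Comparison of the semigroup with unbounded eigenfunctions. -/

theorem latticeVec_add {d : ℕ} (x y : IntLattice d) :
    latticeVec (x + y) = latticeVec x + latticeVec y := by
  ext i
  simp [latticeVec]

theorem latticeVec_zero {d : ℕ} : latticeVec (0 : IntLattice d) = 0 := by
  ext i
  simp [latticeVec]

/-- The exponential series of a bounded operator, after a shift by a constant. -/
theorem hasSum_expSemigroup {B : Type*} [NormedAddCommGroup B] [NormedSpace ℝ B] [CompleteSpace B]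
    (L : B →L[ℝ] B) (c : ℝ) (t : ℝ≥0) (f : B) (φ : B →L[ℝ] ℝ) :
    HasSum (fun n : ℕ => Real.exp (-(t * c)) * ((n.factorial : ℝ)⁻¹ * (t : ℝ) ^ n *
      φ (((L + c • (1 : B →L[ℝ] B)) ^ n) f))) (φ (expSemigroup L t f)) := by
  let _ : NormedAlgebra ℚ (B →L[ℝ] B) := NormedAlgebra.restrictScalars ℚ ℝ _
  set Q := L + c • (1 : B →L[ℝ] B) with hQ
  have h1 : expSemigroup L t = Real.exp (-(t * c)) • NormedSpace.exp ((t : ℝ) • Q) := by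
    have e1 : (t : ℝ) • L = algebraMap ℝ (B →L[ℝ] B) (-(t * c)) + (t : ℝ) • Q := by
      rw [hQ, smul_add, Algebra.algebraMap_eq_smul_one, smul_smul, neg_smul]
      abel
    rw [expSemigroup, e1, NormedSpace.exp_add_of_commute (Algebra.commutes _ _),
      ← NormedSpace.algebraMap_exp_comm, ← Real.exp_eq_exp_ℝ,
      Algebra.algebraMap_eq_smul_one, smul_one_mul]
  have h2 := NormedSpace.exp_series_hasSum_exp' (𝕂 := ℝ) ((t : ℝ) • Q)
  have h3 := (h2.mapL (φ.comp (ContinuousLinearMap.apply ℝ B f))).mul_left (Real.exp (-(t * c)))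
  rw [h1]
  rw [smul_apply, map_smul, smul_eq_mul]
  refine h3.congr_fun fun n => ?_
  rw [smul_pow, smul_smul, map_smul, smul_eq_mul]
  rfl

namespace ActiveParticleModel

variable {d : ℕ} (m : ActiveParticleModel d)

/-- The functions in the domain of the expression `generatorFun`. -/
def DiffusionSummable (f : m.State → ℝ) : Prop :=
  ∀ s : m.State, Summable fun z : IntLattice d => m.p z * (f (s.1 + z, s.2) - f s)

variable {m} in
theorem DiffusionSummable.add_smul {f g : m.State → ℝ} (hf : m.DiffusionSummable f)
    (hg : m.DiffusionSummable g) (a b : ℝ) : m.DiffusionSummable fun s => a * f s + b * g s := by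
  intro s
  refine (((hf s).mul_left a).add ((hg s).mul_left b)).congr fun z => ?_
  ring

variable {m} in
theorem generatorFun_add_smul {f g : m.State → ℝ} (hf : m.DiffusionSummable f)
    (hg : m.DiffusionSummable g) (a b : ℝ) (s : m.State) :
    m.generatorFun (fun s => a * f s + b * g s) s =
      a * m.generatorFun f s + b * m.generatorFun g s := by
  have h1 : m.diffusion (fun s => a * f s + b * g s) s =
      a * m.diffusion f s + b * m.diffusion g s := by
    unfold diffusion
    rw [← tsum_mul_left, ← tsum_mul_left, ← ((hf s).mul_left a).tsum_add ((hg s).mul_left b)]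
    exact tsum_congr fun z => by ring
  have h2 : m.flipGen (fun v => a * f (s.1, v) + b * g (s.1, v)) s.2 =
      a * m.flipGen (fun v => f (s.1, v)) s.2 + b * m.flipGen (fun v => g (s.1, v)) s.2 := by
    unfold flipGen
    rw [Finset.mul_sum, Finset.mul_sum, ← Finset.sum_add_distrib]
    exact Finset.sum_congr rfl fun z _ => by ring
  simp only [generatorFun, transport, h1, h2]
  ring

/-- A bound of the total jump rate. -/
def totalRate : ℝ := m.lam + m.kap + m.gam * ∑ v : m.V, ∑ v' : m.V, |m.flip v v'|

-- Adding the total rate offsets the negative coefficients of `f s`, leaving a nonnegative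
-- combination of values of `f`. No boundedness is asked, so eigenfunctions may be compared with
-- bounded functions.
variable {m} in
theorem generatorFun_add_totalRate_mono {f g : m.State → ℝ} (hf : m.DiffusionSummable f)
    (hg : m.DiffusionSummable g) (hfg : ∀ s, f s ≤ g s) (s : m.State) :
    m.generatorFun f s + m.totalRate * f s ≤ m.generatorFun g s + m.totalRate * g s := by
  have h1 : m.transport f s + f s ≤ m.transport g s + g s := by
    simp only [transport, sub_add_cancel]
    exact hfg _
  have h2 : m.diffusion f s + f s ≤ m.diffusion g s + g s := by
    have e : ∀ f : m.State → ℝ, m.DiffusionSummable f →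
        HasSum (fun z => m.p z * f (s.1 + z, s.2)) (m.diffusion f s + f s) := by
      intro f hf
      have := (hf s).hasSum.add (m.p_hasSum.mul_right (f s))
      rw [one_mul] at this
      refine this.congr_fun fun z => ?_
      ring
    exact hasSum_le (fun z => mul_le_mul_of_nonneg_left (hfg _) (m.p_nonneg z)) (e f hf) (e g hg)
  have h3 : m.flipGen (fun v => f (s.1, v)) s.2 + (∑ v : m.V, ∑ v' : m.V, |m.flip v v'|) * f s ≤
      m.flipGen (fun v => g (s.1, v)) s.2 +
        (∑ v : m.V, ∑ v' : m.V, |m.flip v v'|) * g s := by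
    have e1 : ∑ v' : m.V, |m.flip s.2 v'| ≤ ∑ v : m.V, ∑ v' : m.V, |m.flip v v'| :=
      Finset.single_le_sum (f := fun v : m.V => ∑ v' : m.V, |m.flip v v'|)
        (fun v _ => Finset.sum_nonneg fun v' _ => abs_nonneg _) (Finset.mem_univ s.2)
    have e2 : m.flipGen (fun v => f (s.1, v)) s.2 + (∑ v' : m.V, |m.flip s.2 v'|) * f s ≤
        m.flipGen (fun v => g (s.1, v)) s.2 + (∑ v' : m.V, |m.flip s.2 v'|) * g s := by
      simp only [flipGen, Finset.sum_mul, ← Finset.sum_add_distrib]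
      refine Finset.sum_le_sum fun v' _ => ?_
      by_cases h : s.2 = v'
      · have := mul_le_mul_of_nonneg_left (hfg s) (abs_nonneg (m.flip s.2 v'))
        rw [← h] at this ⊢
        simpa using this
      · rw [abs_of_nonneg (m.flip_nonneg _ _ h)]
        have := mul_le_mul_of_nonneg_left (hfg (s.1, v')) (m.flip_nonneg _ _ h)
        linarith
    have e3 := mul_le_mul_of_nonneg_right e1 (sub_nonneg.2 (hfg s))
    linarith
  have k1 := mul_le_mul_of_nonneg_left h1 m.lam_nonneg
  have k2 := mul_le_mul_of_nonneg_left h2 m.kap_nonneg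
  have k3 := mul_le_mul_of_nonneg_left h3 m.gam_pos.le
  simp only [generatorFun, totalRate]
  linarith

variable {m} in
theorem le_pow_generator_add_totalRate {g : ℕ → m.State → ℝ}
    (hg : ∀ n, m.DiffusionSummable (g n))
    (hsucc : ∀ n s, m.generatorFun (g n) s + m.totalRate * g n s = g (n + 1) s)
    {f : m.State →ᵇ ℝ} (hf : ∀ s, g 0 s ≤ f s) (n : ℕ) (s : m.State) :
    g n s ≤ ((m.generator + m.totalRate • (1 : (m.State →ᵇ ℝ) →L[ℝ] (m.State →ᵇ ℝ))) ^ n) f s := by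
  induction n generalizing s with
  | zero => exact hf s
  | succ n ih =>
    rw [← hsucc, pow_succ']
    exact generatorFun_add_totalRate_mono (hg n) (m.summable_diffusion _) ih s

theorem hasSum_semigroup (t : ℝ≥0) (f : m.State →ᵇ ℝ) (s : m.State) :
    HasSum (fun n : ℕ => Real.exp (-(t * m.totalRate)) * ((n.factorial : ℝ)⁻¹ * (t : ℝ) ^ n *
      ((m.generator + m.totalRate • (1 : (m.State →ᵇ ℝ) →L[ℝ] (m.State →ᵇ ℝ))) ^ n) f s))
      (m.semigroup t f s) :=
  hasSum_expSemigroup m.generator m.totalRate t f (BoundedContinuousFunction.evalCLM ℝ s)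

-- The shifted generator multiplies `g₁` and `g₂` by `F₁ + c` and `F₂ + c`; the order is kept in
-- each power, hence in the exponential series. Two eigenfunctions are allowed so that the second
-- can cut off the first.
variable {m} in
theorem le_semigroup_of_eigenfunctions {g₁ g₂ : m.State → ℝ} {F₁ F₂ : ℝ}
    (hg₁ : m.DiffusionSummable g₁) (hg₂ : m.DiffusionSummable g₂)
    (hF₁ : ∀ s, m.generatorFun g₁ s = F₁ * g₁ s) (hF₂ : ∀ s, m.generatorFun g₂ s = F₂ * g₂ s)
    {a b : ℝ} {f : m.State →ᵇ ℝ} (hf : ∀ s, a * g₁ s + b * g₂ s ≤ f s) (t : ℝ≥0) (s : m.State) :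
    a * (Real.exp (t * F₁) * g₁ s) + b * (Real.exp (t * F₂) * g₂ s) ≤ m.semigroup t f s := by
  set c := m.totalRate with hc
  have hle := le_pow_generator_add_totalRate
    (g := fun n s => a * (F₁ + c) ^ n * g₁ s + b * (F₂ + c) ^ n * g₂ s)
    (fun n => hg₁.add_smul hg₂ _ _)
    (fun n s => by
      rw [generatorFun_add_smul hg₁ hg₂, hF₁, hF₂]
      ring) (f := f) (fun s => by simpa using hf s)
  have hexp : ∀ F : ℝ, HasSum (fun n : ℕ => Real.exp (-(t * c)) *
      ((n.factorial : ℝ)⁻¹ * (t : ℝ) ^ n * (F + c) ^ n)) (Real.exp (t * F)) := by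
    intro F
    have h1 := (NormedSpace.exp_series_hasSum_exp' (𝕂 := ℝ) ((t : ℝ) * (F + c))).mul_left
      (Real.exp (-(t * c)))
    rw [← Real.exp_eq_exp_ℝ, ← Real.exp_add] at h1
    rw [show (t : ℝ) * F = -(t * c) + t * (F + c) by ring]
    refine h1.congr_fun fun n => ?_
    rw [smul_eq_mul, mul_pow, mul_assoc]
  have hsum := (((hexp F₁).mul_right (g₁ s)).mul_left a).add
    (((hexp F₂).mul_right (g₂ s)).mul_left b)
  refine hasSum_le (fun n => ?_) hsum (m.hasSum_semigroup t f s)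
  have := mul_le_mul_of_nonneg_left (hle n s)
    (show 0 ≤ Real.exp (-(t * c)) * ((n.factorial : ℝ)⁻¹ * (t : ℝ) ^ n) by positivity)
  refine le_trans (le_of_eq ?_) (this.trans (le_of_eq ?_)) <;> ring

/-- The function `(x, v) ↦ exp ⟨α, x⟩ r(v)`. -/
noncomputable def expFun (α : EuclideanSpace ℝ (Fin d)) (r : m.V → ℝ) (s : m.State) : ℝ :=
  Real.exp (inner ℝ α (latticeVec s.1)) * r s.2

theorem summable_p_mul_exp_sub_one (α : EuclideanSpace ℝ (Fin d)) :
    Summable fun z : IntLattice d => m.p z * (Real.exp (inner ℝ α (latticeVec z)) - 1) :=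
  ((m.p_exp α).sub m.p_hasSum.summable).congr fun z => by ring

theorem diffusionSummable_expFun (α : EuclideanSpace ℝ (Fin d)) (r : m.V → ℝ) :
    m.DiffusionSummable (m.expFun α r) := by
  intro s
  refine ((m.summable_p_mul_exp_sub_one α).mul_right (m.expFun α r s)).congr fun z => ?_
  simp only [expFun, latticeVec_add, inner_add_right, Real.exp_add]
  ring

theorem generatorFun_expFun (α : EuclideanSpace ℝ (Fin d)) (r : m.V → ℝ) (s : m.State) :
    m.generatorFun (m.expFun α r) s =
      Real.exp (inner ℝ α (latticeVec s.1)) * (m.tiltedMatrix α).mulVec r s.2 := by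
  have h1 : m.diffusion (m.expFun α r) s = m.jumpCumulant α * m.expFun α r s := by
    rw [jumpCumulant, ← tsum_mul_right]
    refine tsum_congr fun z => ?_
    simp only [expFun, latticeVec_add, inner_add_right, Real.exp_add]
    ring
  have h2 : m.flipGen (fun v => m.expFun α r (s.1, v)) s.2 =
      Real.exp (inner ℝ α (latticeVec s.1)) * m.flipGen r s.2 := by
    simp only [flipGen, expFun, Finset.mul_sum]
    exact Finset.sum_congr rfl fun v _ => by ring
  rw [tiltedMatrix, Matrix.add_mulVec, Matrix.smul_mulVec, flipMatrix_mulVec]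
  simp only [generatorFun, h1, h2, transport]
  simp only [expFun, latticeVec_add, inner_add_right, Real.exp_add,
    Pi.add_apply, Pi.smul_apply, smul_eq_mul, Matrix.mulVec_diagonal, potential]
  ring

variable {m} in
theorem generatorFun_expFun_of_eigenvector {α : EuclideanSpace ℝ (Fin d)} {r : m.V → ℝ} {F : ℝ}
    (h : (m.tiltedMatrix α).mulVec r = F • r) (s : m.State) :
    m.generatorFun (m.expFun α r) s = F * m.expFun α r s := by
  rw [generatorFun_expFun, h]
  simp only [Pi.smul_apply, smul_eq_mul, expFun]
  ring

variable {m} {Ω : Type*} [MeasurableSpace Ω] {P : Measure Ω}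
  {X : ℝ≥0 → Ω → IntLattice d} {v : ℝ≥0 → Ω → m.V}

theorem IsActiveParticle.measurable_comp (h : m.IsActiveParticle P X v) (t : ℝ≥0)
    (f : m.State → ℝ) : Measurable fun ω => f (X t ω, v t ω) :=
  (measurable_of_countable f).comp ((h.measurable_pos t).prodMk (h.measurable_vel t))

variable [IsProbabilityMeasure P]

theorem IsActiveParticle.integrable_comp (h : m.IsActiveParticle P X v) (t : ℝ≥0)
    (f : m.State →ᵇ ℝ) : Integrable (fun ω => f (X t ω, v t ω)) P :=
  Integrable.of_bound (h.measurable_comp t f).aestronglyMeasurable ‖f‖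
    (Eventually.of_forall fun _ => f.norm_coe_le_norm _)

/-- This is the Markov property at time zero, integrated, with the initial position replaced by `0`.
-/
theorem IsActiveParticle.integral_comp (h : m.IsActiveParticle P X v) (t : ℝ≥0)
    (f : m.State →ᵇ ℝ) :
    ∫ ω, f (X t ω, v t ω) ∂P = ∫ ω, m.semigroup t f (0, v 0 ω) ∂P := by
  have hm : (⨆ r ∈ Set.Iic (0 : ℝ≥0), MeasurableSpace.comap (fun ω => (X r ω, v r ω))
      inferInstance) ≤ (inferInstance : MeasurableSpace Ω) :=
    iSup₂_le fun r _ => ((h.measurable_pos r).prodMk (h.measurable_vel r)).comap_le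
  have h1 := integral_condExp (μ := P) hm (f := fun ω => f (X (0 + t) ω, v (0 + t) ω))
  rw [integral_congr_ae (h.markov 0 t f)] at h1
  rw [zero_add] at h1
  rw [← h1]
  refine integral_congr_ae ?_
  filter_upwards [h.start] with ω hω
  rw [hω]

end ActiveParticleModel

/-! ### Two-sided bounds on the exponential moments. -/

namespace ActiveParticleModel

variable {d : ℕ} {m : ActiveParticleModel d} {Ω : Type*} [MeasurableSpace Ω] {P : Measure Ω}
  {X : ℝ≥0 → Ω → IntLattice d} {v : ℝ≥0 → Ω → m.V}

theorem expFun_pos {α : EuclideanSpace ℝ (Fin d)} {r : m.V → ℝ} (hr : ∀ w, 0 < r w) (s : m.State) :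
    0 < m.expFun α r s :=
  mul_pos (Real.exp_pos _) (hr _)

theorem expFun_zero (α : EuclideanSpace ℝ (Fin d)) (r : m.V → ℝ) (w : m.V) :
    m.expFun α r (0, w) = r w := by
  simp [expFun, latticeVec_zero]

variable [IsProbabilityMeasure P]

theorem integrable_initial (h : m.IsActiveParticle P X v) (r : m.V → ℝ) :
    Integrable (fun ω => r (v 0 ω)) P :=
  Integrable.of_bound ((measurable_of_countable r).comp (h.measurable_vel 0)).aestronglyMeasurable
    (∑ w, |r w|) (Eventually.of_forall fun ω =>
      Finset.single_le_sum (f := fun w => |r w|) (fun _ _ => abs_nonneg _) (Finset.mem_univ (v 0 ω)))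

theorem integrable_semigroup_initial (h : m.IsActiveParticle P X v) (t : ℝ≥0) (f : m.State →ᵇ ℝ) :
    Integrable (fun ω => m.semigroup t f (0, v 0 ω)) P :=
  integrable_initial h fun w => m.semigroup t f (0, w)

theorem integral_min_expFun_le (h : m.IsActiveParticle P X v) {α : EuclideanSpace ℝ (Fin d)}
    {r : m.V → ℝ} {F : ℝ} (hr : ∀ w, 0 < r w) (hF : (m.tiltedMatrix α).mulVec r = F • r)
    (t : ℝ≥0) (N : ℕ) :
    ∫ ω, min (m.expFun α r (X t ω, v t ω)) N ∂P ≤ Real.exp (t * F) * ∫ ω, r (v 0 ω) ∂P := by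
  -- The comparison yields lower bounds on the semigroup, so the truncated function enters with a
  -- minus sign and the second eigenfunction with coefficient zero.
  let f : m.State →ᵇ ℝ := BoundedContinuousFunction.ofNormedAddCommGroupDiscrete
    (fun s => -min (m.expFun α r s) N) N (fun s => by
      rw [norm_neg, Real.norm_of_nonneg (le_min (expFun_pos hr s).le (Nat.cast_nonneg N))]
      exact min_le_right _ _)
  have hf : ∀ s, (-1) * m.expFun α r s + 0 * m.expFun α r s ≤ f s := fun s => by
    have : min (m.expFun α r s) N ≤ m.expFun α r s := min_le_left _ _
    change _ ≤ -min (m.expFun α r s) N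
    linarith
  have h1 := le_semigroup_of_eigenfunctions (m.diffusionSummable_expFun α r)
    (m.diffusionSummable_expFun α r) (generatorFun_expFun_of_eigenvector hF)
    (generatorFun_expFun_of_eigenvector hF) hf t
  have h2 := h.integral_comp t f
  have h3 : ∫ ω, f (X t ω, v t ω) ∂P = -∫ ω, min (m.expFun α r (X t ω, v t ω)) N ∂P := by
    rw [← integral_neg]
    rfl
  have h4 : ∫ ω, -(Real.exp (t * F) * r (v 0 ω)) ∂P ≤ ∫ ω, m.semigroup t f (0, v 0 ω) ∂P := by
    refine integral_mono ((integrable_initial h r).const_mul _).neg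
      (integrable_semigroup_initial h t f) fun ω => ?_
    have := h1 (0, v 0 ω)
    rw [expFun_zero] at this
    change -(Real.exp (t * F) * r (v 0 ω)) ≤ _
    linarith
  rw [integral_neg, integral_const_mul] at h4
  linarith

/-- The truncated bound is uniform in `N`, so monotone convergence removes the truncation. -/
theorem integrable_expFun (h : m.IsActiveParticle P X v) {α : EuclideanSpace ℝ (Fin d)}
    {r : m.V → ℝ} {F : ℝ} (hr : ∀ w, 0 < r w) (hF : (m.tiltedMatrix α).mulVec r = F • r)
    (t : ℝ≥0) : Integrable (fun ω => m.expFun α r (X t ω, v t ω)) P ∧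
      ∫ ω, m.expFun α r (X t ω, v t ω) ∂P ≤ Real.exp (t * F) * ∫ ω, r (v 0 ω) ∂P := by
  set g := fun ω => m.expFun α r (X t ω, v t ω) with hg
  have hgm : Measurable g := h.measurable_comp t _
  have hg0 : ∀ ω, 0 ≤ g ω := fun ω => (expFun_pos hr _).le
  have hmin : ∀ N : ℕ, Measurable fun ω => min (g ω) N := fun N => hgm.min measurable_const
  have hC : 0 ≤ Real.exp (t * F) * ∫ ω, r (v 0 ω) ∂P :=
    mul_nonneg (Real.exp_pos _).le (integral_nonneg fun ω => (hr _).le)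
  have hle : ∫⁻ ω, ENNReal.ofReal (g ω) ∂P ≤
      ENNReal.ofReal (Real.exp (t * F) * ∫ ω, r (v 0 ω) ∂P) := by
    have hlim := lintegral_tendsto_of_tendsto_of_monotone (μ := P)
      (f := fun (N : ℕ) ω => ENNReal.ofReal (min (g ω) N)) (F := fun ω => ENNReal.ofReal (g ω))
      (fun N => (hmin N).ennreal_ofReal.aemeasurable)
      (Eventually.of_forall fun ω a b hab =>
        ENNReal.ofReal_le_ofReal (min_le_min_left _ (Nat.cast_le.2 hab)))
      (Eventually.of_forall fun ω => by
        refine tendsto_const_nhds.congr' ?_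
        obtain ⟨K, hK⟩ := exists_nat_ge (g ω)
        filter_upwards [eventually_ge_atTop K] with N hN
        rw [min_eq_left (hK.trans (Nat.cast_le.2 hN))])
    refine le_of_tendsto' hlim fun N => ?_
    rw [← ofReal_integral_eq_lintegral_ofReal]
    · exact ENNReal.ofReal_le_ofReal (integral_min_expFun_le h hr hF t N)
    · refine Integrable.of_bound (hmin N).aestronglyMeasurable N (Eventually.of_forall fun ω => ?_)
      rw [Real.norm_of_nonneg (le_min (hg0 ω) (Nat.cast_nonneg N))]
      exact min_le_right _ _
    · exact Eventually.of_forall fun ω => le_min (hg0 ω) (Nat.cast_nonneg N)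
  refine ⟨⟨hgm.aestronglyMeasurable, ?_⟩, ?_⟩
  · rw [hasFiniteIntegral_iff_ofReal (Eventually.of_forall hg0)]
    exact hle.trans_lt ENNReal.ofReal_lt_top
  · rw [integral_eq_lintegral_of_nonneg_ae (Eventually.of_forall hg0) hgm.aestronglyMeasurable]
    exact ENNReal.toReal_le_of_le_ofReal hC hle

theorem le_integral_expFun (h : m.IsActiveParticle P X v) {α : EuclideanSpace ℝ (Fin d)}
    {r r₂ : m.V → ℝ} {F F₂ : ℝ} (hr : ∀ w, 0 < r w) (hr₂ : ∀ w, 0 < r₂ w)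
    (hF : (m.tiltedMatrix α).mulVec r = F • r)
    (hF₂ : (m.tiltedMatrix ((2 : ℝ) • α)).mulVec r₂ = F₂ • r₂) (t : ℝ≥0) :
    Real.exp (t * F) * ∫ ω, r (v 0 ω) ∂P ≤ ∫ ω, m.expFun α r (X t ω, v t ω) ∂P := by
  have : Nonempty Ω := nonempty_of_isProbabilityMeasure P
  have : Nonempty m.V := ⟨v 0 (Classical.arbitrary Ω)⟩
  -- The minimum gives `c * r ^ 2 ≤ r₂`, so the eigenfunction for `2α` dominates `c` times the
  -- square of the one for `α`.
  obtain ⟨w₀, hw₀⟩ := Finite.exists_min fun w => r₂ w / r w ^ 2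
  set c := r₂ w₀ / r w₀ ^ 2
  have hc : 0 < c := div_pos (hr₂ _) (pow_pos (hr _) 2)
  have hsq : ∀ s, c * m.expFun α r s ^ 2 ≤ m.expFun ((2 : ℝ) • α) r₂ s := by
    intro s
    have h1 := (le_div_iff₀ (pow_pos (hr s.2) 2)).1 (hw₀ s.2)
    have h2 := mul_le_mul_of_nonneg_left h1 (Real.exp_pos (inner ℝ ((2 : ℝ) • α)
      (latticeVec s.1))).le
    have h3 : Real.exp (inner ℝ ((2 : ℝ) • α) (latticeVec s.1)) =
        Real.exp (inner ℝ α (latticeVec s.1)) ^ 2 := by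
      rw [real_inner_smul_left, ← Real.exp_nat_mul]
      norm_num
    refine le_trans (le_of_eq ?_) h2
    rw [h3, expFun]
    ring
  have key : ∀ ε : ℝ, 0 < ε → Real.exp (t * F) * ∫ ω, r (v 0 ω) ∂P -
      ε * (Real.exp (t * F₂) * ∫ ω, r₂ (v 0 ω) ∂P) ≤ ∫ ω, m.expFun α r (X t ω, v t ω) ∂P := by
    intro ε hε
    -- With `k = ε * c`, this is `x - k * x ^ 2 ≤ 1 / (4 * k)`. The positive part of the difference
    -- is thus bounded, and still lies below the eigenfunction for `α`.
    have hbd : ∀ s, m.expFun α r s - ε * m.expFun ((2 : ℝ) • α) r₂ s ≤ (4 * (ε * c))⁻¹ := by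
      intro s
      have h1 := mul_le_mul_of_nonneg_left (hsq s) hε.le
      have h2 : m.expFun α r s - ε * c * m.expFun α r s ^ 2 ≤ (4 * (ε * c))⁻¹ := by
        have hk : 0 < ε * c := mul_pos hε hc
        have : (4 * (ε * c))⁻¹ - (m.expFun α r s - ε * c * m.expFun α r s ^ 2) =
            (2 * (ε * c) * m.expFun α r s - 1) ^ 2 / (4 * (ε * c)) := by
          field_simp
          ring
        have h0 : 0 ≤ (2 * (ε * c) * m.expFun α r s - 1) ^ 2 / (4 * (ε * c)) := by positivity
        linarith
      linarith
    let f : m.State →ᵇ ℝ := BoundedContinuousFunction.ofNormedAddCommGroupDiscrete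
      (fun s => max (m.expFun α r s - ε * m.expFun ((2 : ℝ) • α) r₂ s) 0) (4 * (ε * c))⁻¹
      (fun s => by
        rw [Real.norm_of_nonneg (le_max_right _ _)]
        exact max_le (hbd s) (by positivity))
    have hf : ∀ s, 1 * m.expFun α r s + (-ε) * m.expFun ((2 : ℝ) • α) r₂ s ≤ f s := fun s => by
      refine le_trans (le_of_eq (by ring)) (le_max_left _ _)
    have h1 := le_semigroup_of_eigenfunctions (m.diffusionSummable_expFun α r)
      (m.diffusionSummable_expFun _ r₂) (generatorFun_expFun_of_eigenvector hF)
      (generatorFun_expFun_of_eigenvector hF₂) hf t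
    have h2 := h.integral_comp t f
    have h3 : ∫ ω, f (X t ω, v t ω) ∂P ≤ ∫ ω, m.expFun α r (X t ω, v t ω) ∂P := by
      refine integral_mono (h.integrable_comp t f) (integrable_expFun h hr hF t).1 fun ω => ?_
      have e1 := (expFun_pos (α := α) hr (X t ω, v t ω)).le
      have e2 := mul_nonneg hε.le (expFun_pos (α := (2 : ℝ) • α) hr₂ (X t ω, v t ω)).le
      exact max_le (by linarith) e1
    have h4 : ∫ ω, (Real.exp (t * F) * r (v 0 ω) - ε * (Real.exp (t * F₂) * r₂ (v 0 ω))) ∂P ≤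
        ∫ ω, m.semigroup t f (0, v 0 ω) ∂P := by
      refine integral_mono (((integrable_initial h r).const_mul _).sub
        (((integrable_initial h r₂).const_mul _).const_mul _))
        (integrable_semigroup_initial h t f) fun ω => ?_
      have := h1 (0, v 0 ω)
      rw [expFun_zero, expFun_zero] at this
      refine le_trans (le_of_eq ?_) this
      ring
    rw [integral_sub ((integrable_initial h r).const_mul _)
      (((integrable_initial h r₂).const_mul _).const_mul _), integral_const_mul,
      integral_const_mul, integral_const_mul] at h4
    linarith
  have hlim : Tendsto (fun ε : ℝ => Real.exp (t * F) * ∫ ω, r (v 0 ω) ∂P -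
      ε * (Real.exp (t * F₂) * ∫ ω, r₂ (v 0 ω) ∂P)) (𝓝[>] 0)
      (𝓝 (Real.exp (t * F) * ∫ ω, r (v 0 ω) ∂P)) := by
    have : ContinuousAt (fun ε : ℝ => Real.exp (t * F) * ∫ ω, r (v 0 ω) ∂P -
      ε * (Real.exp (t * F₂) * ∫ ω, r₂ (v 0 ω) ∂P)) 0 := by fun_prop
    have := this.tendsto
    simp only [zero_mul, sub_zero] at this
    exact this.mono_left nhdsWithin_le_nhds
  exact le_of_tendsto hlim (eventually_nhdsWithin_of_forall fun ε hε => key ε hε)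

/-- The exponential moments grow at the rate given by a positive eigenvector. -/
theorem exists_moment_bounds (h : m.IsActiveParticle P X v) {α : EuclideanSpace ℝ (Fin d)}
    {r r₂ : m.V → ℝ} {F F₂ : ℝ} (hr : ∀ w, 0 < r w) (hr₂ : ∀ w, 0 < r₂ w)
    (hF : (m.tiltedMatrix α).mulVec r = F • r)
    (hF₂ : (m.tiltedMatrix ((2 : ℝ) • α)).mulVec r₂ = F₂ • r₂) :
    (∀ t, Integrable (fun ω => Real.exp (inner ℝ α (latticeVec (X t ω)))) P) ∧
      ∃ c C : ℝ, 0 < c ∧ 0 < C ∧ ∀ t : ℝ≥0,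
        c * Real.exp (t * F) ≤ ∫ ω, Real.exp (inner ℝ α (latticeVec (X t ω))) ∂P ∧
        ∫ ω, Real.exp (inner ℝ α (latticeVec (X t ω))) ∂P ≤ C * Real.exp (t * F) := by
  have : Nonempty Ω := nonempty_of_isProbabilityMeasure P
  have : Nonempty m.V := ⟨v 0 (Classical.arbitrary Ω)⟩
  obtain ⟨w₀, hmin⟩ := Finite.exists_min r
  obtain ⟨w₁, hmax⟩ := Finite.exists_max r
  have hmeas : ∀ t, Measurable fun ω => Real.exp (inner ℝ α (latticeVec (X t ω))) := fun t =>
    h.measurable_comp t fun s => Real.exp (inner ℝ α (latticeVec s.1))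
  have hint : ∀ t, Integrable (fun ω => Real.exp (inner ℝ α (latticeVec (X t ω)))) P := by
    intro t
    refine ((integrable_expFun h hr hF t).1.const_mul (r w₀)⁻¹).mono' (hmeas t).aestronglyMeasurable
      (Eventually.of_forall fun ω => ?_)
    rw [Real.norm_of_nonneg (Real.exp_pos _).le, expFun, le_inv_mul_iff₀ (hr w₀), mul_comm]
    exact mul_le_mul_of_nonneg_left (hmin _) (Real.exp_pos _).le
  have hI : r w₀ ≤ ∫ ω, r (v 0 ω) ∂P ∧ ∫ ω, r (v 0 ω) ∂P ≤ r w₁ := by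
    constructor
    · simpa using integral_mono (μ := P) (integrable_const (r w₀)) (integrable_initial h r)
        fun ω => hmin (v 0 ω)
    · simpa using integral_mono (μ := P) (integrable_initial h r) (integrable_const (r w₁))
        fun ω => hmax (v 0 ω)
  refine ⟨hint, r w₀ / r w₁, r w₁ / r w₀, div_pos (hr _) (hr _), div_pos (hr _) (hr _),
    fun t => ⟨?_, ?_⟩⟩
  · have h1 := le_integral_expFun h hr hr₂ hF hF₂ t
    have h2 : ∫ ω, m.expFun α r (X t ω, v t ω) ∂P ≤
        r w₁ * ∫ ω, Real.exp (inner ℝ α (latticeVec (X t ω))) ∂P := by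
      rw [← integral_const_mul]
      refine integral_mono (integrable_expFun h hr hF t).1 ((hint t).const_mul _) fun ω => ?_
      simp only [expFun]
      rw [mul_comm]
      exact mul_le_mul_of_nonneg_right (hmax _) (Real.exp_pos _).le
    have h3 := mul_le_mul_of_nonneg_left hI.1 (Real.exp_pos (t * F)).le
    rw [div_mul_eq_mul_div, div_le_iff₀ (hr w₁)]
    linarith
  · have h1 := (integrable_expFun h hr hF t).2
    have h2 : r w₀ * ∫ ω, Real.exp (inner ℝ α (latticeVec (X t ω))) ∂P ≤
        ∫ ω, m.expFun α r (X t ω, v t ω) ∂P := by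
      rw [← integral_const_mul]
      refine integral_mono ((hint t).const_mul _) (integrable_expFun h hr hF t).1 fun ω => ?_
      simp only [expFun]
      rw [mul_comm (Real.exp _)]
      exact mul_le_mul_of_nonneg_right (hmin _) (Real.exp_pos _).le
    have h3 := mul_le_mul_of_nonneg_left hI.2 (Real.exp_pos (t * F)).le
    rw [div_mul_eq_mul_div, le_div_iff₀ (hr w₀)]
    linarith

end ActiveParticleModel

/-! ### Regularity of the potential in `α`. -/

namespace ActiveParticleModel

variable {d : ℕ} (m : ActiveParticleModel d)

theorem continuous_jumpCumulant : Continuous m.jumpCumulant := by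
  have hconv : ConvexOn ℝ Set.univ m.jumpCumulant := by
    refine ⟨convex_univ, fun α _ β _ a b ha hb hab => ?_⟩
    simp only [jumpCumulant, smul_eq_mul]
    rw [← tsum_mul_left, ← tsum_mul_left, ← ((m.summable_p_mul_exp_sub_one α).mul_left a).tsum_add
      ((m.summable_p_mul_exp_sub_one β).mul_left b)]
    refine (m.summable_p_mul_exp_sub_one _).tsum_le_tsum (fun z => ?_)
      (((m.summable_p_mul_exp_sub_one α).mul_left a).add
        ((m.summable_p_mul_exp_sub_one β).mul_left b))
    have h1 := convexOn_exp.2 (Set.mem_univ (inner ℝ α (latticeVec z)))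
      (Set.mem_univ (inner ℝ β (latticeVec z))) ha hb hab
    simp only [smul_eq_mul] at h1
    rw [inner_add_left, real_inner_smul_left, real_inner_smul_left]
    have h2 := mul_le_mul_of_nonneg_left h1 (m.p_nonneg z)
    have h3 : m.p z * (a + b) = m.p z := by rw [hab, mul_one]
    linarith
  exact continuousOn_univ.1 (hconv.continuousOn isOpen_univ)

theorem differentiableAt_jumpCumulant (α β : EuclideanSpace ℝ (Fin d)) :
    DifferentiableAt ℝ (fun s : ℝ => m.jumpCumulant (α + s • β)) 0 := by
  -- For `|s| < 1`, `|y| * exp (s * y) ≤ exp (2 * |y|) ≤ exp (2 * y) + exp (-2 * y)`. Exponential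
  -- moments at `α ± 2β` therefore dominate the differentiated series.
  set u : IntLattice d → ℝ := fun z =>
    Real.exp (inner ℝ (α + (2 : ℝ) • β) (latticeVec z)) * m.p z +
      Real.exp (inner ℝ (α + (-2 : ℝ) • β) (latticeVec z)) * m.p z with hu
  have hus : Summable u := (m.p_exp _).add (m.p_exp _)
  have hd := hasDerivAt_tsum_of_isPreconnected (t := Set.Ioo (-1 : ℝ) 1) hus isOpen_Ioo
    isPreconnected_Ioo
    (g := fun z s => m.p z * (Real.exp (inner ℝ (α + s • β) (latticeVec z)) - 1))
    (g' := fun z s => m.p z * (Real.exp (inner ℝ (α + s • β) (latticeVec z)) *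
      inner ℝ β (latticeVec z))) (y₀ := 0) (y := 0)
    (fun z s _ => by
      have h1 : HasDerivAt (fun s : ℝ => inner ℝ (α + s • β) (latticeVec z))
          (inner ℝ β (latticeVec z)) s := by
        simp only [inner_add_left, real_inner_smul_left]
        simpa using ((hasDerivAt_id s).mul_const (inner ℝ β (latticeVec z))).const_add
          (inner ℝ α (latticeVec z))
      exact (h1.exp.sub_const 1).const_mul (m.p z))
    (fun z s hs => by
      set y : ℝ := inner ℝ β (latticeVec z)
      set x : ℝ := inner ℝ α (latticeVec z)
      have hpz := m.p_nonneg z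
      have hkey : Real.exp (x + s * y) * |y| ≤ Real.exp (x + 2 * y) + Real.exp (x + (-2) * y) := by
        have e1 : |y| ≤ Real.exp |y| := by linarith [Real.add_one_le_exp |y|]
        have e2 : s * y ≤ |y| := by
          refine (le_abs_self _).trans ?_
          rw [abs_mul]
          exact mul_le_of_le_one_left (abs_nonneg y) (abs_le.2 ⟨hs.1.le, hs.2.le⟩)
        have e3 : Real.exp (x + s * y) * |y| ≤ Real.exp (x + 2 * |y|) := by
          have : x + 2 * |y| = (x + |y|) + |y| := by ring
          rw [this, Real.exp_add (x + |y|)]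
          gcongr
        refine e3.trans ?_
        rcases abs_cases y with ⟨h, -⟩ | ⟨h, -⟩ <;> rw [h]
        · linarith [Real.exp_pos (x + (-2) * y)]
        · rw [show x + 2 * -y = x + (-2) * y by ring]
          linarith [Real.exp_pos (x + 2 * y)]
      rw [norm_mul, norm_mul, Real.norm_of_nonneg hpz, Real.norm_of_nonneg (Real.exp_pos _).le,
        Real.norm_eq_abs]
      simp only [hu, inner_add_left, real_inner_smul_left]
      have := mul_le_mul_of_nonneg_left hkey hpz
      linarith)
    (by simp) (by simpa using m.summable_p_mul_exp_sub_one α) (by simp)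
  exact hd.differentiableAt

theorem continuous_potential (w : m.V) : Continuous fun α => m.potential α w := by
  unfold potential
  have := m.continuous_jumpCumulant
  fun_prop

theorem differentiableAt_potential (α β : EuclideanSpace ℝ (Fin d)) (w : m.V) :
    DifferentiableAt ℝ (fun s : ℝ => m.potential (α + s • β) w) 0 := by
  unfold potential
  have h1 := m.differentiableAt_jumpCumulant α β
  simp only [inner_add_left, real_inner_smul_left]
  fun_prop

theorem isMetzlerIrreducible_flipMatrix : IsMetzlerIrreducible (m.gam • m.flipMatrix) where
  offDiag_nonneg i j hij := by
    rw [Matrix.smul_apply, flipMatrix, if_neg hij]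
    exact mul_nonneg m.gam_pos.le (m.flip_nonneg i j hij)
  irreducible i j := by
    refine Relation.ReflTransGen.mono (fun a b hab => ⟨hab.1, ?_⟩) _ _ (m.flip_irreducible i j)
    rw [Matrix.smul_apply, flipMatrix, if_neg hab.1]
    exact mul_pos m.gam_pos hab.2

end ActiveParticleModel

/-! ### Exponential rates of probabilities in the extended reals. -/

section LogarithmicRates

variable {Ω : Type*} [MeasurableSpace Ω] {P : Measure Ω} [IsFiniteMeasure P] {A : ℝ≥0 → Set Ω}
  {K c : ℝ}

theorem coe_mul_log_ofReal_mul_exp (hK : 0 < K) {t : ℝ≥0} (ht : 0 < t) :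
    (((t : ℝ)⁻¹ : ℝ) : EReal) * ENNReal.log (ENNReal.ofReal (K * Real.exp (-(t * c)))) =
      (((t : ℝ)⁻¹ * Real.log K - c : ℝ) : EReal) := by
  have ht' : (t : ℝ) ≠ 0 := by exact_mod_cast ht.ne'
  have hpos : 0 < K * Real.exp (-(t * c)) := mul_pos hK (Real.exp_pos _)
  rw [ENNReal.log_pos_real (ENNReal.ofReal_pos.2 hpos).ne' ENNReal.ofReal_ne_top,
    ENNReal.toReal_ofReal hpos.le, ← EReal.coe_mul, Real.log_mul hK.ne' (Real.exp_pos _).ne',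
    Real.log_exp]
  congr 1
  field_simp
  ring

theorem tendsto_inv_mul_const_sub (K c : ℝ) :
    Tendsto (fun t : ℝ≥0 => (((t : ℝ)⁻¹ * K - c : ℝ) : EReal)) atTop (𝓝 ((-c : ℝ) : EReal)) := by
  refine (continuous_coe_real_ereal.tendsto _).comp ?_
  have h : Tendsto (fun t : ℝ≥0 => (t : ℝ)⁻¹) atTop (𝓝 0) :=
    tendsto_inv_atTop_zero.comp (NNReal.tendsto_coe_atTop.2 tendsto_id)
  simpa using (h.mul_const K).sub_const c

theorem limsup_log_measure_le (hK : 0 < K)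
    (h : ∀ t, 0 < t → P.real (A t) ≤ K * Real.exp (-(t * c))) :
    limsup (fun t : ℝ≥0 => (((t : ℝ)⁻¹ : ℝ) : EReal) * ENNReal.log (P (A t))) atTop ≤
      ((-c : ℝ) : EReal) := by
  rw [← (tendsto_inv_mul_const_sub (Real.log K) c).limsup_eq]
  refine limsup_le_limsup ?_
  filter_upwards [eventually_gt_atTop 0] with t ht
  rw [← coe_mul_log_ofReal_mul_exp hK ht, ← ofReal_measureReal]
  exact mul_le_mul_of_nonneg_left (ENNReal.log_monotone (ENNReal.ofReal_le_ofReal (h t ht)))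
    (EReal.coe_nonneg.2 (by positivity))

theorem le_liminf_log_measure (hK : 0 < K)
    (h : ∀ᶠ t : ℝ≥0 in atTop, K * Real.exp (-(t * c)) ≤ P.real (A t)) :
    ((-c : ℝ) : EReal) ≤
      liminf (fun t : ℝ≥0 => (((t : ℝ)⁻¹ : ℝ) : EReal) * ENNReal.log (P (A t))) atTop := by
  rw [← (tendsto_inv_mul_const_sub (Real.log K) c).liminf_eq]
  refine liminf_le_liminf ?_
  filter_upwards [eventually_gt_atTop 0, h] with t ht hle
  rw [← coe_mul_log_ofReal_mul_exp hK ht, ← ofReal_measureReal]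
  exact mul_le_mul_of_nonneg_left (ENNReal.log_monotone (ENNReal.ofReal_le_ofReal hle))
    (EReal.coe_nonneg.2 (by positivity))

end LogarithmicRates

/-! ### The Legendre transform: compactness and approximation by gradients. -/

/-- The positive and negative coordinate directions. -/
noncomputable def axisDirection {d : ℕ} (j : Fin d × Bool) : EuclideanSpace ℝ (Fin d) :=
  if j.2 then EuclideanSpace.single j.1 1 else -EuclideanSpace.single j.1 1

theorem norm_le_of_inner_axisDirection_le {d : ℕ} {z : EuclideanSpace ℝ (Fin d)} {δ : ℝ}
    (h : ∀ j, inner ℝ (axisDirection j) z ≤ δ) : ‖z‖ ≤ d * δ := by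
  have h1 : ∀ i, ‖z i‖ ≤ δ := by
    intro i
    have e1 := h (i, true)
    have e2 := h (i, false)
    simp only [axisDirection, if_true, inner_neg_left, EuclideanSpace.inner_single_left,
      Bool.false_eq_true, if_false, map_one, one_mul] at e1 e2
    exact abs_le.2 ⟨by linarith, e1⟩
  calc ‖z‖ = ‖∑ i, z i • EuclideanSpace.single i (1 : ℝ)‖ := by
        congr 1
        ext k
        simp [Finset.sum_apply, Pi.single_apply]
    _ ≤ ∑ i, ‖z i • EuclideanSpace.single i (1 : ℝ)‖ := norm_sum_le _ _
    _ ≤ ∑ _i : Fin d, δ := Finset.sum_le_sum fun i _ => by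
        rw [norm_smul, PiLp.norm_single, norm_one, mul_one]
        exact h1 i
    _ = d * δ := by simp

section LegendreTransform

variable {d : ℕ} {F : EuclideanSpace ℝ (Fin d) → ℝ}

theorem le_legendreTransform (F : EuclideanSpace ℝ (Fin d) → ℝ) (α x : EuclideanSpace ℝ (Fin d)) :
    ((inner ℝ α x - F α : ℝ) : EReal) ≤ legendreTransform F x :=
  le_iSup (fun α => ((inner ℝ α x - F α : ℝ) : EReal)) α

theorem legendreTransform_nonneg (h0 : F 0 = 0) (x : EuclideanSpace ℝ (Fin d)) :
    0 ≤ legendreTransform F x := by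
  simpa [h0] using le_legendreTransform F 0 x

theorem legendreTransform_le_coe_iff {x : EuclideanSpace ℝ (Fin d)} {c : ℝ} :
    legendreTransform F x ≤ (c : EReal) ↔ ∀ α, inner ℝ α x - F α ≤ c := by
  simp only [legendreTransform, iSup_le_iff, EReal.coe_le_coe_iff]

theorem lowerSemicontinuous_legendreTransform (F : EuclideanSpace ℝ (Fin d) → ℝ) :
    LowerSemicontinuous (legendreTransform F) := by
  refine lowerSemicontinuous_iSup fun α => Continuous.lowerSemicontinuous ?_
  exact continuous_coe_real_ereal.comp (by fun_prop)

/-- Testing with the `2d` directions `±e_i`, where `F` is finite, already bounds every coordinate on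
a sublevel set. -/
theorem isCompact_legendreTransform_le (F : EuclideanSpace ℝ (Fin d) → ℝ) (c : ℝ) :
    IsCompact {x | legendreTransform F x ≤ (c : EReal)} := by
  refine (isCompact_closedBall (0 : EuclideanSpace ℝ (Fin d))
    (d * ∑ j : Fin d × Bool, |c + F (axisDirection j)|)).of_isClosed_subset
    ((lowerSemicontinuous_legendreTransform F).isClosed_preimage (c : EReal)) fun x hx => ?_
  rw [mem_closedBall_zero_iff]
  refine norm_le_of_inner_axisDirection_le fun j => ?_
  have h1 := legendreTransform_le_coe_iff.1 hx (axisDirection j)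
  have h2 : |c + F (axisDirection j)| ≤ ∑ j : Fin d × Bool, |c + F (axisDirection j)| :=
    Finset.single_le_sum (f := fun j : Fin d × Bool => |c + F (axisDirection j)|)
      (fun _ _ => abs_nonneg _) (Finset.mem_univ j)
  linarith [le_abs_self (c + F (axisDirection j))]

/-- A closed set on which the Legendre transform exceeds `c` is covered by finitely many of the
half-spaces which define the Legendre transform. -/
theorem exists_finset_halfSpace_cover {B : Set (EuclideanSpace ℝ (Fin d))} (hB : IsClosed B) {c : ℝ}
    (hc : ∀ x ∈ B, (c : EReal) < legendreTransform F x) :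
    ∃ T : Finset (EuclideanSpace ℝ (Fin d)), ∀ x ∈ B, ∃ α ∈ T, c < inner ℝ α x - F α := by
  classical
  set R := ∑ j : Fin d × Bool, |c + F (axisDirection j)|
  have hcpt : IsCompact (B ∩ Metric.closedBall 0 (d * R)) :=
    (isCompact_closedBall _ _).inter_left hB
  obtain ⟨T, hT⟩ := hcpt.elim_finite_subcover (fun α => {x | c < inner ℝ α x - F α})
    (fun α => isOpen_lt (by fun_prop) (by fun_prop)) (fun x hx => by
      have h1 := hc x hx.1
      rw [← not_le, legendreTransform_le_coe_iff] at h1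
      push Not at h1
      exact Set.mem_iUnion.2 h1)
  -- The half-spaces of the coordinate directions cover everything outside a ball; compactness is
  -- needed only inside it.
  refine ⟨T ∪ Finset.univ.image axisDirection, fun x hx => ?_⟩
  by_cases h : ∃ j, c < inner ℝ (axisDirection j) x - F (axisDirection j)
  · obtain ⟨j, hj⟩ := h
    exact ⟨_, Finset.mem_union_right _ (Finset.mem_image_of_mem _ (Finset.mem_univ j)), hj⟩
  · push Not at h
    have hxR : x ∈ Metric.closedBall 0 (d * R) := by
      rw [mem_closedBall_zero_iff]
      refine norm_le_of_inner_axisDirection_le fun j => ?_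
      have h2 : |c + F (axisDirection j)| ≤ R :=
        Finset.single_le_sum (f := fun j : Fin d × Bool => |c + F (axisDirection j)|)
          (fun _ _ => abs_nonneg _) (Finset.mem_univ j)
      linarith [h j, le_abs_self (c + F (axisDirection j))]
    obtain ⟨α, hα, hx'⟩ := Set.mem_iUnion₂.1 (hT ⟨hx, hxR⟩)
    exact ⟨α, Finset.mem_union_left _ hα, hx'⟩

/-- Points at which the Legendre transform is at most `K` are approximated by gradients of `F`. -/
theorem exists_gradient_near (h0 : F 0 = 0) (hF : Continuous F)
    (hdiff : ∀ α β, DifferentiableAt ℝ (fun s : ℝ => F (α + s • β)) 0)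
    {x : EuclideanSpace ℝ (Fin d)} {K : ℝ} (hK : ∀ α, inner ℝ α x - F α ≤ K) {ρ : ℝ} (hρ : 0 < ρ) :
    ∃ α y : EuclideanSpace ℝ (Fin d), dist y x < ρ ∧ inner ℝ α y - F α ≤ K ∧
      ∀ β, HasDerivAt (fun s : ℝ => F (α + s • β)) (inner ℝ β y) 0 := by
  have hK0 : 0 ≤ K := by simpa [h0] using hK 0
  set ε : ℝ := ρ ^ 2 / (4 * (K + 1)) with hε
  have hεpos : 0 < ε := by positivity
  set φ : EuclideanSpace ℝ (Fin d) → ℝ := fun α => F α + ε / 2 * ‖α‖ ^ 2 - inner ℝ α x with hφ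
  have hφc : Continuous φ := by fun_prop
  have hcoer : Tendsto φ (cocompact _) atTop := by
    have h1 : Tendsto (fun α : EuclideanSpace ℝ (Fin d) => ε / 2 * ‖α‖ ^ 2 + -K)
        (cocompact _) atTop :=
      tendsto_atTop_add_const_right _ _ (((tendsto_pow_atTop two_ne_zero).comp
        (tendsto_norm_cocompact_atTop)).const_mul_atTop (by positivity))
    refine tendsto_atTop_mono (fun α => ?_) h1
    have := hK α
    simp only [hφ]
    linarith
  obtain ⟨α, hα⟩ := hφc.exists_forall_le hcoer
  have hα0 := hα 0
  simp only [hφ, h0, norm_zero, inner_zero_left] at hα0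
  have hαK := hK α
  have hinner : inner ℝ α (x - ε • α) = inner ℝ α x - ε * ‖α‖ ^ 2 := by
    rw [inner_sub_right, real_inner_smul_right, real_inner_self_eq_norm_sq]
  refine ⟨α, x - ε • α, ?_, ?_, fun β => ?_⟩
  · rw [dist_eq_norm, sub_sub_cancel_left, norm_neg, norm_smul, Real.norm_of_nonneg hεpos.le]
    refine lt_of_pow_lt_pow_left₀ 2 hρ.le ?_
    have h1 : ε * ‖α‖ ^ 2 ≤ 2 * K := by linarith
    calc (ε * ‖α‖) ^ 2 = ε * (ε * ‖α‖ ^ 2) := by ring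
      _ ≤ ε * (2 * K) := by gcongr
      _ < ρ ^ 2 := by
        rw [hε, div_mul_eq_mul_div, div_lt_iff₀ (by positivity)]
        have : 0 < ρ ^ 2 := by positivity
        nlinarith
  · rw [hinner]
    have : 0 ≤ ε * ‖α‖ ^ 2 := by positivity
    linarith
  · have h1 := (hdiff α β).hasDerivAt
    have hn : ∀ s : ℝ, ‖α + s • β‖ ^ 2 = ‖α‖ ^ 2 + s * (2 * inner ℝ α β) + s ^ 2 * ‖β‖ ^ 2 := by
      intro s
      rw [norm_add_sq_real, real_inner_smul_right, norm_smul, mul_pow, Real.norm_eq_abs, sq_abs]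
      ring
    have h2 : HasDerivAt (fun s : ℝ => φ (α + s • β))
        (deriv (fun s : ℝ => F (α + s • β)) 0 + ε / 2 * (2 * inner ℝ α β) - inner ℝ β x) 0 := by
      simp only [hφ, hn, inner_add_left, real_inner_smul_left]
      refine (h1.add (HasDerivAt.const_mul _ ?_)).sub ?_
      · have := (((hasDerivAt_id (0 : ℝ)).mul_const (2 * inner ℝ α β)).const_add (‖α‖ ^ 2)).add
          ((hasDerivAt_pow 2 (0 : ℝ)).mul_const (‖β‖ ^ 2))
        exact this.congr_deriv (by simp)
      · simpa using ((hasDerivAt_id (0 : ℝ)).mul_const (inner ℝ β x)).const_add (inner ℝ α x)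
    have hmin : IsLocalMin (fun s : ℝ => φ (α + s • β)) 0 :=
      Eventually.of_forall fun s => by simpa using hα (α + s • β)
    have h3 := hmin.hasDerivAt_eq_zero h2
    have h4 : deriv (fun s : ℝ => F (α + s • β)) 0 = inner ℝ β (x - ε • α) := by
      rw [inner_sub_right, real_inner_smul_right, real_inner_comm α β]
      linarith
    rwa [h4] at h1

end LegendreTransform

/-! ### The Gärtner-Ellis theorem. -/

section GaertnerEllis

variable {d : ℕ} {F : EuclideanSpace ℝ (Fin d) → ℝ} {Ω : Type*} [MeasurableSpace Ω] {P : Measure Ω}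
  [IsProbabilityMeasure P] {X : ℝ≥0 → Ω → EuclideanSpace ℝ (Fin d)}

theorem measureReal_halfSpace_le {α : EuclideanSpace ℝ (Fin d)} {C : ℝ} {t : ℝ≥0} (ht : 0 < t)
    (hint : Integrable (fun ω => Real.exp (inner ℝ α (X t ω))) P)
    (hC : ∫ ω, Real.exp (inner ℝ α (X t ω)) ∂P ≤ C * Real.exp (t * F α)) (c : ℝ) :
    P.real {ω | c < inner ℝ α ((t : ℝ)⁻¹ • X t ω) - F α} ≤ C * Real.exp (-(t * c)) := by
  have ht' : (0 : ℝ) < t := by exact_mod_cast ht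
  have h1 := ProbabilityTheory.measure_ge_le_exp_mul_mgf (μ := P)
    (X := fun ω => inner ℝ α (X t ω)) (t := 1) (t * (c + F α)) zero_le_one (by simpa using hint)
  simp only [ProbabilityTheory.mgf, one_mul] at h1
  refine (measureReal_mono fun ω hω => ?_).trans (h1.trans ?_)
  · simp only [Set.mem_ofPred_eq, real_inner_smul_right] at hω ⊢
    have h2 : c + F α < (t : ℝ)⁻¹ * inner ℝ α (X t ω) := by linarith
    rw [inv_mul_eq_div, lt_div_iff₀ ht'] at h2
    linarith
  · refine (mul_le_mul_of_nonneg_left hC (Real.exp_pos _).le).trans (le_of_eq ?_)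
    rw [mul_left_comm, ← Real.exp_add]
    congr 2
    ring

/-- The slope at zero is below `⟨β, y⟩ + δ`, so a small extra tilt along `β` gains exponentially on
the half-space where `⟨β, x - y⟩ > δ`. -/
theorem exists_tilt_decay {α β y : EuclideanSpace ℝ (Fin d)} {δ : ℝ} (hδ : 0 < δ)
    (hy : HasDerivAt (fun s : ℝ => F (α + s • β)) (inner ℝ β y) 0) :
    ∃ s : ℝ, 0 < s ∧ F (α + s • β) - s * (inner ℝ β y + δ) < F α := by
  have h1 := hasDerivAt_iff_tendsto_slope.1 hy
  have h2 : Tendsto (slope (fun s : ℝ => F (α + s • β)) 0) (𝓝[>] 0) (𝓝 (inner ℝ β y)) :=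
    h1.mono_left (nhdsWithin_mono _ fun s hs => (Set.mem_Ioi.1 hs).ne')
  obtain ⟨s, hs, hs0⟩ := ((h2.eventually_lt_const
    (show inner ℝ β y < inner ℝ β y + δ by linarith)).and self_mem_nhdsWithin).exists
  have hs0' : 0 < s := hs0
  refine ⟨s, hs0', ?_⟩
  rw [slope_def_field, sub_zero, zero_smul, add_zero, div_lt_iff₀ hs0'] at hs
  linarith

/-- The lower bound at gradients of `F`, by exponential tilting. -/
theorem exists_eventually_le_measureReal_ball (hX : ∀ t, Measurable (X t))
    (hint : ∀ α t, Integrable (fun ω => Real.exp (inner ℝ α (X t ω))) P)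
    (hbd : ∀ α, ∃ c C : ℝ, 0 < c ∧ 0 < C ∧ ∀ t : ℝ≥0,
      c * Real.exp (t * F α) ≤ ∫ ω, Real.exp (inner ℝ α (X t ω)) ∂P ∧
      ∫ ω, Real.exp (inner ℝ α (X t ω)) ∂P ≤ C * Real.exp (t * F α))
    {α y : EuclideanSpace ℝ (Fin d)}
    (hy : ∀ β, HasDerivAt (fun s : ℝ => F (α + s • β)) (inner ℝ β y) 0) {ρ : ℝ} (hρ : 0 < ρ) :
    ∃ κ : ℝ, 0 < κ ∧ ∀ᶠ t : ℝ≥0 in atTop,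
      κ * Real.exp (-(t * (inner ℝ α y - F α + ‖α‖ * ρ))) ≤
        P.real {ω | (t : ℝ)⁻¹ • X t ω ∈ Metric.closedBall y ρ} := by
  -- The `+ 1` keeps the quotient meaningful for `d = 0`. A point outside the ball exceeds `δ` in
  -- some direction `±e_i`.
  set δ : ℝ := ρ / (d + 1) with hδ
  have hδ0 : 0 < δ := by positivity
  have hdδ : d * δ ≤ ρ := by
    rw [hδ, mul_div_assoc', div_le_iff₀ (by positivity)]
    nlinarith
  obtain ⟨c, _, hc, -, hlow⟩ := hbd α
  choose s hs0 hs using fun j : Fin d × Bool => exists_tilt_decay hδ0 (hy (axisDirection j))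
  choose _ C _ hC0 hC using hbd
  set γ : Fin d × Bool → EuclideanSpace ℝ (Fin d) := fun j => α + s j • axisDirection j with hγ
  set η : Fin d × Bool → ℝ := fun j =>
    F α - (F (γ j) - s j * (inner ℝ (axisDirection j) y + δ)) with hη
  have hη0 : ∀ j, 0 < η j := fun j => sub_pos.2 (hs j)
  have hmain : ∀ t : ℝ≥0, 0 < t → c * Real.exp (t * F α) ≤
      P.real {ω | (t : ℝ)⁻¹ • X t ω ∈ Metric.closedBall y ρ} *
        Real.exp (t * (inner ℝ α y + ‖α‖ * ρ)) +
      ∑ j, C (γ j) * Real.exp (t * (F α - η j)) := by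
    intro t ht
    have ht' : (0 : ℝ) < t := by exact_mod_cast ht
    set D := {ω | (t : ℝ)⁻¹ • X t ω ∈ Metric.closedBall y ρ} with hD
    have hDm : MeasurableSet D :=
      measurableSet_preimage ((hX t).const_smul (t : ℝ)⁻¹) Metric.isClosed_closedBall.measurableSet
    -- In the ball, `⟨α, ·⟩` exceeds its value at `y` by at most `‖α‖ * ρ`. Outside, one of the
    -- extra tilts `s j` raises the exponent; after integration these terms are smaller than `exp (t
    -- * F α)` by the factors `exp (-(t * η j))`.
    have hpt : ∀ ω, Real.exp (inner ℝ α (X t ω)) ≤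
        D.indicator (fun _ => Real.exp (t * (inner ℝ α y + ‖α‖ * ρ))) ω +
        ∑ j, Real.exp (-(t * (s j * (inner ℝ (axisDirection j) y + δ)))) *
          Real.exp (inner ℝ (γ j) (X t ω)) := by
      intro ω
      have hXt : X t ω = (t : ℝ) • ((t : ℝ)⁻¹ • X t ω) := (smul_inv_smul₀ ht'.ne' _).symm
      have hnn : ∀ j, 0 ≤ Real.exp (-(t * (s j * (inner ℝ (axisDirection j) y + δ)))) *
          Real.exp (inner ℝ (γ j) (X t ω)) := fun j => by positivity
      by_cases hω : ω ∈ D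
      · rw [Set.indicator_of_mem hω]
        refine le_add_of_le_of_nonneg (Real.exp_le_exp.2 ?_) (Finset.sum_nonneg fun j _ => hnn j)
        rw [hXt, real_inner_smul_right]
        refine mul_le_mul_of_nonneg_left ?_ ht'.le
        have h1 := real_inner_le_norm α ((t : ℝ)⁻¹ • X t ω - y)
        have h2 : ‖(t : ℝ)⁻¹ • X t ω - y‖ ≤ ρ := mem_closedBall_iff_norm.1 hω
        rw [inner_sub_right] at h1
        have := mul_le_mul_of_nonneg_left h2 (norm_nonneg α)
        linarith
      · rw [Set.indicator_of_notMem hω, zero_add]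
        have hex : ∃ j, δ < inner ℝ (axisDirection j) ((t : ℝ)⁻¹ • X t ω - y) := by
          by_contra! hcon
          exact hω (mem_closedBall_iff_norm.2 ((norm_le_of_inner_axisDirection_le hcon).trans hdδ))
        obtain ⟨j, hj⟩ := hex
        refine le_trans ?_ (Finset.single_le_sum (fun j _ => hnn j) (Finset.mem_univ j))
        rw [← Real.exp_add, Real.exp_le_exp]
        simp only [hγ, inner_add_left, real_inner_smul_left]
        rw [inner_sub_right, real_inner_smul_right, lt_sub_iff_add_lt, inv_mul_eq_div,
          lt_div_iff₀ ht'] at hj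
        have := mul_le_mul_of_nonneg_left hj.le (hs0 j).le
        linarith
    have hI1 : Integrable (D.indicator fun _ => Real.exp (t * (inner ℝ α y + ‖α‖ * ρ))) P :=
      (integrable_const _).indicator hDm
    have hI2 : ∀ j ∈ Finset.univ, Integrable (fun ω =>
        Real.exp (-(t * (s j * (inner ℝ (axisDirection j) y + δ)))) *
          Real.exp (inner ℝ (γ j) (X t ω))) P := fun j _ => (hint (γ j) t).const_mul _
    have h1 := integral_mono (hint α t) (hI1.add (integrable_finsetSum _ hI2)) hpt
    simp only [Pi.add_apply] at h1
    rw [integral_add hI1 (integrable_finsetSum _ hI2), integral_indicator_const _ hDm,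
      integral_finsetSum _ hI2, smul_eq_mul] at h1
    refine (hlow t).1.trans (h1.trans ?_)
    gcongr with j _
    rw [integral_const_mul]
    refine (mul_le_mul_of_nonneg_left (hC (γ j) t).2 (Real.exp_pos _).le).trans (le_of_eq ?_)
    rw [mul_left_comm, ← Real.exp_add]
    congr 2
    simp only [hη]
    ring
  have hlim : Tendsto (fun t : ℝ≥0 => ∑ j, C (γ j) * Real.exp (-(t * η j))) atTop (𝓝 0) := by
    have : Tendsto (fun t : ℝ≥0 => ∑ j, C (γ j) * Real.exp (-(t * η j))) atTop
        (𝓝 (∑ j : Fin d × Bool, C (γ j) * 0)) := by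
      refine tendsto_finsetSum _ fun j _ => Tendsto.const_mul _ ?_
      refine Real.tendsto_exp_neg_atTop_nhds_zero.comp ?_
      exact (NNReal.tendsto_coe_atTop.2 tendsto_id).atTop_mul_const (hη0 j)
    simpa using this
  refine ⟨c / 2, half_pos hc, ?_⟩
  filter_upwards [eventually_gt_atTop 0, hlim.eventually_lt_const (half_pos hc)] with t ht hsmall
  have h1 := hmain t ht
  have h2 : ∑ j, C (γ j) * Real.exp (t * (F α - η j)) ≤ c / 2 * Real.exp (t * F α) := by
    refine le_trans (le_of_eq ?_) (mul_le_mul_of_nonneg_right hsmall.le (Real.exp_pos _).le)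
    rw [Finset.sum_mul]
    refine Finset.sum_congr rfl fun j _ => ?_
    rw [mul_assoc, ← Real.exp_add]
    congr 2
    ring
  refine le_of_mul_le_mul_right ?_ (Real.exp_pos (t * (inner ℝ α y + ‖α‖ * ρ)))
  rw [mul_assoc, ← Real.exp_add]
  have h3 : -(t * (inner ℝ α y - F α + ‖α‖ * ρ)) + t * (inner ℝ α y + ‖α‖ * ρ) = t * F α := by
    ring
  rw [h3]
  linarith

/-- The **Gärtner-Ellis theorem**, for a free energy which is finite, continuous and differentiable
along lines, and with exponential moments comparable with `exp (t F)`. -/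
theorem satisfiesLDP_legendreTransform (hX : ∀ t, Measurable (X t)) (h0 : F 0 = 0)
    (hF : Continuous F) (hdiff : ∀ α β, DifferentiableAt ℝ (fun s : ℝ => F (α + s • β)) 0)
    (hint : ∀ α t, Integrable (fun ω => Real.exp (inner ℝ α (X t ω))) P)
    (hbd : ∀ α, ∃ c C : ℝ, 0 < c ∧ 0 < C ∧ ∀ t : ℝ≥0,
      c * Real.exp (t * F α) ≤ ∫ ω, Real.exp (inner ℝ α (X t ω)) ∂P ∧
      ∫ ω, Real.exp (inner ℝ α (X t ω)) ∂P ≤ C * Real.exp (t * F α)) :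
    SatisfiesLDP P (fun t ω => (t : ℝ)⁻¹ • X t ω) (legendreTransform F) where
  nonneg := legendreTransform_nonneg h0
  lowerSemicontinuous := lowerSemicontinuous_legendreTransform F
  compact_sublevel := isCompact_legendreTransform_le F
  upper_bound B hB := by
    -- Working with every real `c` below the infimum also covers an infinite infimum.
    rw [EReal.le_neg, ← EReal.ge_of_forall_gt_iff_ge]
    intro c hc
    rw [EReal.le_neg]
    obtain ⟨T, hT⟩ := exists_finset_halfSpace_cover (F := F) hB
      fun x hx => hc.trans_le (iInf₂_le x hx)
    choose _ C _ hC0 hC using hbd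
    -- The summand `1` keeps the constant positive when `T` is empty.
    refine (limsup_log_measure_le (K := 1 + ∑ α ∈ T, C α) (c := c)
      (add_pos_of_pos_of_nonneg one_pos (Finset.sum_nonneg fun α _ => (hC0 α).le))
      fun t ht => ?_).trans_eq (EReal.coe_neg c)
    calc P.real {ω | (t : ℝ)⁻¹ • X t ω ∈ B}
        ≤ P.real (⋃ α ∈ T, {ω | c < inner ℝ α ((t : ℝ)⁻¹ • X t ω) - F α}) := by
          refine measureReal_mono (fun ω hω => ?_) (measure_ne_top _ _)
          obtain ⟨α, hα, h⟩ := hT _ hω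
          exact Set.mem_iUnion₂.2 ⟨α, hα, h⟩
      _ ≤ ∑ α ∈ T, P.real {ω | c < inner ℝ α ((t : ℝ)⁻¹ • X t ω) - F α} :=
          measureReal_biUnion_finset_le _ _
      _ ≤ ∑ α ∈ T, C α * Real.exp (-(t * c)) :=
          Finset.sum_le_sum fun α _ => measureReal_halfSpace_le ht (hint α t) (hC α t).2 c
      _ ≤ _ := by
          rw [← Finset.sum_mul]
          exact mul_le_mul_of_nonneg_right (by linarith) (Real.exp_pos _).le
  lower_bound G hG := by
    rw [EReal.neg_le]
    refine le_iInf₂ fun x hx => ?_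
    rw [← EReal.le_of_forall_lt_iff_le]
    intro z hz
    obtain ⟨K, hK1, hK2⟩ := EReal.lt_iff_exists_real_btwn.1 hz
    rw [EReal.coe_lt_coe_iff] at hK2
    obtain ⟨ρ₀, hρ₀, hball⟩ := Metric.isOpen_iff.1 hG x hx
    obtain ⟨α, y, hyx, hαK, hy⟩ := exists_gradient_near h0 hF hdiff
      (legendreTransform_le_coe_iff.1 hK1.le) (half_pos hρ₀)
    -- The first bound keeps the ball around `y` inside `G`, as `y` is within `ρ₀ / 2` of `x`; the
    -- second makes the tilting cost `‖α‖ * ρ` fit between `K` and `z`.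
    set ρ := min (ρ₀ / 4) ((z - K) / (‖α‖ + 1)) with hρ
    have hρ0 : 0 < ρ := lt_min (by positivity) (div_pos (by linarith) (by positivity))
    have hαρ : ‖α‖ * ρ ≤ z - K := by
      have h1 : ρ * (‖α‖ + 1) ≤ z - K := (le_div_iff₀ (by positivity)).1 (min_le_right _ _)
      linarith
    have hsub : Metric.closedBall y ρ ⊆ G := fun w hw => hball (by
      have h1 : dist w y ≤ ρ := hw
      have h2 : ρ ≤ ρ₀ / 4 := min_le_left _ _
      have h3 := dist_triangle w y x
      exact Metric.mem_ball.2 (by linarith))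
    obtain ⟨κ, hκ, hev⟩ := exists_eventually_le_measureReal_ball hX hint hbd hy hρ0
    rw [EReal.neg_le, ← EReal.coe_neg]
    refine le_liminf_log_measure hκ ?_
    filter_upwards [hev] with t ht
    refine le_trans ?_ (ht.trans (measureReal_mono fun ω hω => hsub hω))
    gcongr
    linarith

end GaertnerEllis

/-- Multiplicative bounds by `exp (t F)` determine the logarithmic growth rate. -/
theorem tendsto_inv_mul_log_of_exp_bounds {u : ℝ≥0 → ℝ} {c C F : ℝ} (hc : 0 < c) (hC : 0 < C)
    (h : ∀ t : ℝ≥0, c * Real.exp (t * F) ≤ u t ∧ u t ≤ C * Real.exp (t * F)) :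
    Tendsto (fun t : ℝ≥0 => (t : ℝ)⁻¹ * Real.log (u t)) atTop (𝓝 F) := by
  have hinv : Tendsto (fun t : ℝ≥0 => (t : ℝ)⁻¹) atTop (𝓝 0) :=
    tendsto_inv_atTop_zero.comp (NNReal.tendsto_coe_atTop.2 tendsto_id)
  have hlim : ∀ K : ℝ, Tendsto (fun t : ℝ≥0 => (t : ℝ)⁻¹ * K + F) atTop (𝓝 F) := fun K => by
    simpa using (hinv.mul_const K).add_const F
  have hlog : ∀ K : ℝ, 0 < K → ∀ t : ℝ≥0, 0 < t →
      (t : ℝ)⁻¹ * Real.log (K * Real.exp (t * F)) = (t : ℝ)⁻¹ * Real.log K + F := by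
    intro K hK t ht
    have ht' : (t : ℝ) ≠ 0 := by exact_mod_cast ht.ne'
    rw [Real.log_mul hK.ne' (Real.exp_pos _).ne', Real.log_exp]
    field_simp
  refine tendsto_of_tendsto_of_tendsto_of_le_of_le' (hlim (Real.log c)) (hlim (Real.log C)) ?_ ?_
  · filter_upwards [eventually_gt_atTop 0] with t ht
    rw [← hlog c hc t ht]
    exact mul_le_mul_of_nonneg_left (Real.log_le_log (mul_pos hc (Real.exp_pos _)) (h t).1)
      (by positivity)
  · filter_upwards [eventually_gt_atTop 0] with t ht
    rw [← hlog C hC t ht]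
    exact mul_le_mul_of_nonneg_left
      (Real.log_le_log ((mul_pos hc (Real.exp_pos _)).trans_le (h t).1) (h t).2) (by positivity)

/-! ### Variational formulas for the Perron eigenvalue. -/

namespace ActiveParticleModel

variable {d : ℕ} {m : ActiveParticleModel d} {α : EuclideanSpace ℝ (Fin d)} {F : ℝ} {r l : m.V → ℝ}

theorem isMetzlerIrreducible_tiltedMatrix (m : ActiveParticleModel d)
    (α : EuclideanSpace ℝ (Fin d)) : IsMetzlerIrreducible (m.tiltedMatrix α) :=
  m.isMetzlerIrreducible_flipMatrix.add_diagonal _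

theorem sum_tiltedMatrix_mulVec_div {f : m.V → ℝ} (hf : ∀ w, 0 < f w) (μ : m.V → ℝ) :
    ∑ w, (m.tiltedMatrix α).mulVec f w / f w * μ w =
      ∑ w, m.potential α w * μ w + m.gam * ∑ w, m.flipGen f w / f w * μ w := by
  rw [Finset.mul_sum, ← Finset.sum_add_distrib]
  refine Finset.sum_congr rfl fun w _ => ?_
  rw [tiltedMatrix, Matrix.add_mulVec, Matrix.smul_mulVec, flipMatrix_mulVec]
  simp only [Pi.add_apply, Pi.smul_apply, smul_eq_mul, Matrix.mulVec_diagonal]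
  have := (hf w).ne'
  field_simp
  ring

theorem sum_mulVec_div_of_mem_stdSimplex (h : IsPerronTriple (m.tiltedMatrix α) F r l)
    {μ : m.V → ℝ} (hμ : μ ∈ stdSimplex ℝ m.V) :
    ∑ w, (m.tiltedMatrix α).mulVec r w / r w * μ w = F := by
  rw [h.mulVec_right]
  calc ∑ w, (F • r) w / r w * μ w = ∑ w, F * μ w := by
        refine Finset.sum_congr rfl fun w _ => ?_
        rw [Pi.smul_apply, smul_eq_mul, mul_div_cancel_right₀ _ (h.right_pos w).ne']
    _ = F := by rw [← Finset.mul_sum, hμ.2, mul_one]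

/-- The Donsker-Varadhan formula for the Perron eigenvalue. -/
theorem isLUB_donskerVaradhan (h : IsPerronTriple (m.tiltedMatrix α) F r l) :
    IsLUB ((fun μ : m.V → ℝ =>
      ∑ w, m.potential α w * μ w - m.gam * m.donskerVaradhan μ) '' stdSimplex ℝ m.V) F := by
  have hM := m.isMetzlerIrreducible_tiltedMatrix α
  have : Nonempty m.V := h.nonempty
  have : Nonempty {f : m.V → ℝ // ∀ w, 0 < f w} := ⟨⟨r, h.right_pos⟩⟩
  refine IsGreatest.isLUB ⟨?_, ?_⟩
  · set S := ∑ w, l w * r w with hS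
    have hS0 : 0 < S := h.sum_left_mul_right_pos
    -- For this measure the infimum over `f` is attained at `f = r`.
    set μ : m.V → ℝ := fun w => l w * r w / S with hμ
    have hμS : μ ∈ stdSimplex ℝ m.V :=
      ⟨fun w => div_nonneg (mul_pos (h.left_pos w) (h.right_pos w)).le hS0.le, by
        rw [hμ, ← Finset.sum_div, div_self hS0.ne']⟩
    have hle : ∀ f : {f : m.V → ℝ // ∀ w, 0 < f w},
        (F - ∑ w, m.potential α w * μ w) / m.gam ≤ ∑ w, m.flipGen f.1 w / f.1 w * μ w := by
      intro f
      have h1 := h.le_sum_mulVec_div hM f.2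
      have h2 := sum_tiltedMatrix_mulVec_div (α := α) f.2 μ
      have h3 : ∑ w, (m.tiltedMatrix α).mulVec f.1 w / f.1 w * μ w =
          (∑ w, (m.tiltedMatrix α).mulVec f.1 w / f.1 w * (l w * r w)) / S := by
        rw [Finset.sum_div]
        exact Finset.sum_congr rfl fun w _ => by rw [hμ]; ring
      rw [← le_div_iff₀ hS0, ← h3, h2] at h1
      rw [div_le_iff₀ m.gam_pos]
      linarith
    have hr : (F - ∑ w, m.potential α w * μ w) / m.gam = ∑ w, m.flipGen r w / r w * μ w := by
      have h1 := sum_tiltedMatrix_mulVec_div (α := α) h.right_pos μ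
      rw [sum_mulVec_div_of_mem_stdSimplex h hμS] at h1
      rw [div_eq_iff m.gam_pos.ne']
      linarith
    refine ⟨μ, hμS, ?_⟩
    have hinf : ⨅ f : {f : m.V → ℝ // ∀ w, 0 < f w}, ∑ w, m.flipGen f.1 w / f.1 w * μ w =
        (F - ∑ w, m.potential α w * μ w) / m.gam :=
      le_antisymm ((ciInf_le (m.bddBelow_donskerVaradhan μ hμS) ⟨r, h.right_pos⟩).trans_eq hr.symm)
        (le_ciInf hle)
    simp only [donskerVaradhan]
    rw [hinf, mul_neg, mul_div_cancel₀ _ m.gam_pos.ne']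
    ring
  · rintro _ ⟨μ, hμ, rfl⟩
    have h1 := sum_tiltedMatrix_mulVec_div (α := α) h.right_pos μ
    have h2 := sum_mulVec_div_of_mem_stdSimplex h hμ
    have h3 := mul_le_mul_of_nonneg_left
      (ciInf_le (m.bddBelow_donskerVaradhan μ hμ) ⟨r, h.right_pos⟩) m.gam_pos.le
    simp only [donskerVaradhan]
    linarith

/-- On probability vectors the diffusive part of the potential contributes the constant `kap *
Γ(α)`. -/
theorem isLUB_donskerVaradhan_sub (h : IsPerronTriple (m.tiltedMatrix α) F r l) :
    IsLUB ((fun μ : m.V → ℝ =>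
      ∑ w : m.V, m.lam * (Real.exp (inner ℝ α (latticeVec (w : IntLattice d))) - 1) * μ w
        - m.gam * m.donskerVaradhan μ) '' stdSimplex ℝ m.V) (F - m.kap * m.jumpCumulant α) := by
  have hshift : ∀ μ ∈ stdSimplex ℝ m.V, ∑ w, m.potential α w * μ w = m.kap * m.jumpCumulant α +
      ∑ w : m.V, m.lam * (Real.exp (inner ℝ α (latticeVec (w : IntLattice d))) - 1) * μ w := by
    intro μ hμ
    simp only [potential, add_mul, Finset.sum_add_distrib]
    rw [← Finset.mul_sum, hμ.2, mul_one]
  obtain ⟨hub, hlub⟩ := isLUB_donskerVaradhan h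
  constructor
  · rintro _ ⟨μ, hμ, rfl⟩
    have := hub ⟨μ, hμ, rfl⟩
    simp only [hshift μ hμ] at this ⊢
    linarith
  · intro b hb
    have : F ≤ m.kap * m.jumpCumulant α + b := hlub (by
      rintro _ ⟨μ, hμ, rfl⟩
      have := hb ⟨μ, hμ, rfl⟩
      simp only [hshift μ hμ] at this ⊢
      linarith)
    linarith

theorem isLUB_symmetric (h : IsPerronTriple (m.tiltedMatrix α) F r l)
    (hsymm : ∀ w w', m.flip w w' = m.flip w' w) :
    IsLUB ((fun μ : m.V → ℝ => ∑ w, m.potential α w * μ w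
      + m.gam * ∑ w, ∑ w', √(μ w) * √(μ w') * m.flipMatrix w w') '' stdSimplex ℝ m.V) F := by
  have hM := m.isMetzlerIrreducible_tiltedMatrix α
  have hMsymm : ∀ w w', m.tiltedMatrix α w w' = m.tiltedMatrix α w' w := by
    intro w w'
    by_cases hw : w = w'
    · rw [hw]
    · simp only [tiltedMatrix, Matrix.add_apply, Matrix.smul_apply, flipMatrix, if_neg hw,
        if_neg (Ne.symm hw), Matrix.diagonal_apply_ne _ hw, Matrix.diagonal_apply_ne _ (Ne.symm hw),
        hsymm w w']
  have hform : ∀ μ ∈ stdSimplex ℝ m.V, ∑ w, m.potential α w * μ w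
      + m.gam * ∑ w, ∑ w', √(μ w) * √(μ w') * m.flipMatrix w w' =
      ∑ w, ∑ w', √(μ w) * √(μ w') * m.tiltedMatrix α w w' := by
    intro μ hμ
    rw [Finset.mul_sum, ← Finset.sum_add_distrib]
    refine Finset.sum_congr rfl fun w _ => ?_
    simp only [tiltedMatrix, Matrix.add_apply, Matrix.smul_apply, smul_eq_mul, mul_add,
      Finset.sum_add_distrib]
    have h1 : ∑ w', √(μ w) * √(μ w') * Matrix.diagonal (m.potential α) w w' =
        m.potential α w * μ w := by
      rw [Finset.sum_eq_single w (fun w' _ hw => by rw [Matrix.diagonal_apply_ne _ hw.symm, mul_zero])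
        (fun hw => absurd (Finset.mem_univ w) hw), Matrix.diagonal_apply_eq,
        Real.mul_self_sqrt (hμ.1 w), mul_comm]
    rw [h1, Finset.mul_sum, add_comm]
    congr 1
    exact Finset.sum_congr rfl fun w' _ => by ring
  refine IsGreatest.isLUB ⟨?_, ?_⟩
  · have : Nonempty m.V := h.nonempty
    set S := ∑ w, r w ^ 2 with hS
    have hS0 : 0 < S := Finset.sum_pos (fun w _ => pow_pos (h.right_pos w) 2) Finset.univ_nonempty
    have hμS : (fun w => r w ^ 2 / S) ∈ stdSimplex ℝ m.V :=
      ⟨fun w => by positivity, by rw [← Finset.sum_div, div_self hS0.ne']⟩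
    -- The vector of square roots is the normalised Perron eigenvector, at which the quadratic form
    -- equals `F`.
    refine ⟨fun w => r w ^ 2 / S, hμS, (hform _ hμS).trans ?_⟩
    have hsqrt : ∀ w w', √(r w ^ 2 / S) * √(r w' ^ 2 / S) = r w * r w' / S := by
      intro w w'
      rw [Real.sqrt_div (sq_nonneg _), Real.sqrt_div (sq_nonneg _), Real.sqrt_sq (h.right_pos w).le,
        Real.sqrt_sq (h.right_pos w').le, div_mul_div_comm, Real.mul_self_sqrt hS0.le]
    simp only [hsqrt]
    calc ∑ w, ∑ w', r w * r w' / S * m.tiltedMatrix α w w'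
        = ∑ w, r w / S * ∑ w', m.tiltedMatrix α w w' * r w' := by
          refine Finset.sum_congr rfl fun w _ => ?_
          rw [Finset.mul_sum]
          exact Finset.sum_congr rfl fun w' _ => by ring
      _ = ∑ w, F * (r w ^ 2 / S) := by
          refine Finset.sum_congr rfl fun w _ => ?_
          rw [h.mulVec_right_apply]
          ring
      _ = F := by rw [← Finset.mul_sum, hμS.2, mul_one]
  · rintro _ ⟨μ, hμ, rfl⟩
    refine (hform μ hμ).trans_le ((h.sum_mul_mulVec_le_of_symm hM.offDiag_nonneg hMsymm _).trans_eq ?_)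
    rw [Finset.sum_congr rfl fun w _ => Real.sq_sqrt (hμ.1 w), hμ.2, mul_one]

end ActiveParticleModel

/-! ### Assembly of the theorem. -/

theorem mainTheorem2 {d : ℕ} (m : ActiveParticleModel d)
    {Ω : Type*} [MeasurableSpace Ω] (P : Measure Ω) [IsProbabilityMeasure P]
    (X : ℝ≥0 → Ω → IntLattice d) (v : ℝ≥0 → Ω → m.V) (hXv : m.IsActiveParticle P X v) :
    ∃ F : EuclideanSpace ℝ (Fin d) → ℝ,
      -- the free energy is well defined: finite exponential moments and existence of the limit
      (∀ α, (∀ t, Integrable (fun ω => Real.exp (inner ℝ α (latticeVec (X t ω)))) P) ∧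
        Tendsto (fun t : ℝ≥0 =>
            (t : ℝ)⁻¹ * Real.log (∫ ω, Real.exp (inner ℝ α (latticeVec (X t ω))) ∂P))
          atTop (𝓝 (F α))) ∧
      -- it is the largest eigenvalue of `M(α)`: a real eigenvalue, and no complex eigenvalue has
      -- a larger real part
      (∀ α, Module.End.HasEigenvalue (Matrix.toLin' (m.tiltedMatrix α)) (F α) ∧
        ∀ z : ℂ, Module.End.HasEigenvalue
            (Matrix.toLin' ((m.tiltedMatrix α).map (fun r : ℝ => (r : ℂ)))) z → z.re ≤ F α) ∧
      -- the variational formula, in its two forms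
      (∀ α, IsLUB ((fun μ : m.V → ℝ =>
            ∑ w, m.potential α w * μ w - m.gam * m.donskerVaradhan μ) '' stdSimplex ℝ m.V)
          (F α)) ∧
      (∀ α, IsLUB ((fun μ : m.V → ℝ =>
            ∑ w : m.V, m.lam * (Real.exp (inner ℝ α (latticeVec (w : IntLattice d))) - 1) * μ w
              - m.gam * m.donskerVaradhan μ) '' stdSimplex ℝ m.V)
          (F α - m.kap * m.jumpCumulant α)) ∧
      -- the symmetric case
      ((∀ w w', m.flip w w' = m.flip w' w) → ∀ α, IsLUB ((fun μ : m.V → ℝ =>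
            ∑ w, m.potential α w * μ w
              + m.gam * ∑ w, ∑ w', √(μ w) * √(μ w') * m.flipMatrix w w') '' stdSimplex ℝ m.V)
          (F α)) ∧
      -- the large deviation principle for `X_t / t`
      SatisfiesLDP P (fun t ω => (t : ℝ)⁻¹ • latticeVec (X t ω)) (legendreTransform F) := by
  have : Nonempty Ω := nonempty_of_isProbabilityMeasure P
  have : Nonempty m.V := ⟨v 0 (Classical.arbitrary Ω)⟩
  choose F r l h using fun α => (m.isMetzlerIrreducible_tiltedMatrix α).exists_isPerronTriple
  have hmom := fun α => ActiveParticleModel.exists_moment_bounds hXv (h α).right_pos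
    (h ((2 : ℝ) • α)).right_pos (h α).mulVec_right (h ((2 : ℝ) • α)).mulVec_right
  have hlim : ∀ α, Tendsto (fun t : ℝ≥0 =>
      (t : ℝ)⁻¹ * Real.log (∫ ω, Real.exp (inner ℝ α (latticeVec (X t ω))) ∂P)) atTop
      (𝓝 (F α)) := fun α => by
    obtain ⟨-, c, C, hc, hC, hb⟩ := hmom α
    exact tendsto_inv_mul_log_of_exp_bounds hc hC hb
  -- The moment at `α = 0` is one, so its growth rate vanishes.
  have hF0 : F 0 = 0 := tendsto_nhds_unique (hlim 0) (by simp)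
  have hFcont : Continuous F := by
    have hψ : Continuous m.potential := continuous_pi m.continuous_potential
    refine continuous_iff_continuousAt.2 fun α => tendsto_iff_dist_tendsto_zero.2 ?_
    exact squeeze_zero (fun _ => dist_nonneg) (fun β => (h α).abs_sub_le (h β))
      (tendsto_iff_norm_sub_tendsto_zero.1 (hψ.tendsto α))
  have hdiff : ∀ α β, DifferentiableAt ℝ (fun s : ℝ => F (α + s • β)) 0 := fun α β =>
    differentiableAt_of_isPerronTriple m.isMetzlerIrreducible_flipMatrix
      (fun s => h (α + s • β)) (m.differentiableAt_potential α β)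
  refine ⟨F, fun α => ⟨(hmom α).1, hlim α⟩, fun α => ⟨(h α).hasEigenvalue, fun z hz =>
    (h α).re_le_of_hasEigenvalue (m.isMetzlerIrreducible_tiltedMatrix α) hz⟩,
    fun α => ActiveParticleModel.isLUB_donskerVaradhan (h α),
    fun α => ActiveParticleModel.isLUB_donskerVaradhan_sub (h α),
    fun hsymm α => ActiveParticleModel.isLUB_symmetric (h α) hsymm, ?_⟩
  exact satisfiesLDP_legendreTransform
    (fun t => (measurable_of_countable latticeVec).comp (hXv.measurable_pos t)) hF0 hFcont hdiff
    (fun α => (hmom α).1) (fun α => (hmom α).2)
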